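/- Let $0<\alpha<\pi/2$ and $S_\alpha=\{z\in\mathbb C:\operatorname{Re}z>0,\ |\arg z|<\alpha\}$. Let $H(S_\alpha)$ be the space of holomorphic functions on $S_\alpha$ with the topology of locally uniform convergence, and let $\phi$ be a continuous linear functional on $H(S_\alpha)$ induced by a complex Borel measure $\mu$ with compact support in $S_\alpha$, that is, $\langle g,\phi\rangle=\int_{S_\alpha}g\,d\mu$ for all $g\in H(S_\alpha)$. Assume that $\mu$ is symmetric, $\mu(\overline E)=\overline{\mu(E)}$ for all Borel sets $E\subset S_\alpha$, and that $\int_{S_\alpha}d\mu=0$. Let $f(z)=\langle e_{-z},\phi\rangle$, where $e_{-z}(\xi)=e^{-z\xi}$, be the Fourier–Borel transform of $\phi$, and suppose that $f(x)\in\mathbb R$ for all $x>0$. For an analytic semigroup $T=(T(t))_{t\in S_\alpha}$ in a complex Banach algebra $B$ (with or without unit), i.e. a norm-holomorphic map $T:S_\alpha\to B$ with $T(s+t)=T(s)T(t)$, formally $T(t)=\exp(tA)$, put $f(-tA)=\int_{S_\alpha}T(t\xi)\,d\mu(\xi)$ for $t>0$. Let $\rho$ denote the spectral radius, let $\mathcal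 A$ be the closed subalgebra of $B$ generated by $\{T(t):t\in S_\alpha\}$ (not necessarily unital), let $\operatorname{rad}\mathcal A$ be its radical, i.e. the set of elements of $\mathcal A$ with spectral radius $0$, and let $\pi:\mathcal A\to\mathcal A/\operatorname{rad}\mathcal A$ be the canonical surjection. Call $T$ quasinilpotent if $\rho(T(t))=0$ for all $t\in S_\alpha$. (1) Let $T$ be a non-quasinilpotent analytic semigroup on $S_\alpha$ in a complex Banach algebra. If there is $t_0>0$ such that $$\rho(f(-tA))<\sup_{x>0}|f(x)|\qquad\text{for all }0<t\le t_0,$$ then $\mathcal A/\operatorname{rad}\mathcal A$ is unital, with unit $e$ say, and the semigroup $(\pi(T(t)))_{t\in S_\alpha}$ has a bounded generator: there is $u\in\mathcal A/\operatorname{rad}\mathcal A$ with $\pi(T(t))=e+\sum_{k\ge1}(tu)^k/k!$ for all $t\in S_\alpha$. (2) This is sharp: let $T(t):x\mapsto x^t$ in the Banach algebra $C_0([0,1])$ of continuous complex functions on $[0,1]$ vanishing at $0$. Then $(T(t))_{t\in S_\alpha}$ is a non-quasinilpotent analytic semigroup with $$\rho(f(-tA))=\sup_{x>0}|f(x)|\qquad\text{for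 all }t>0,$$ but $\mathcal A/\operatorname{rad}\mathcal A$ is not unital, and $T(t)$ has no norm limit as $t\to0^+$. -/

import Mathlib

open MeasureTheory Set Filter Topology
open scoped ENNReal

noncomputable section

namespace SectorSemigroup

/-! ### Sectors, holomorphic functions on them, and analytic functionals -/

/-- The open sector `S_α = {z : Re z > 0, |arg z| < α}`. -/
def sector (α : ℝ) : Set ℂ := {z | 0 < z.re ∧ |z.arg| < α}

/-- The space `H(S_α)` of holomorphic functions on the sector.  Its topology is induced by the
compact-open topology of `C(S_α, ℂ)`: it is the topology of locally uniform convergence. -/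
def holSpace (α : ℝ) : Submodule ℂ C(sector α, ℂ) where
  carrier := {g | ∃ G : ℂ → ℂ, DifferentiableOn ℂ G (sector α) ∧ ∀ z : sector α, g z = G z}
  add_mem' := by
    rintro g h ⟨G, hG, hg⟩ ⟨H, hH, hh⟩
    exact ⟨G + H, hG.add hH, fun z => by simp [hg, hh]⟩
  zero_mem' := ⟨0, differentiableOn_const 0, fun z => by simp⟩
  smul_mem' := by
    rintro c g ⟨G, hG, hg⟩
    exact ⟨c • G, hG.const_smul c, fun z => by simp [hg]⟩

/-- The function `e_{-z} : ξ ↦ exp (-z ξ)` as an element of `H(S_α)`. -/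
def expNeg (α : ℝ) (z : ℂ) : holSpace α :=
  ⟨⟨fun ξ => Complex.exp (-z * ξ), by fun_prop⟩,
    fun ξ => Complex.exp (-z * ξ), by fun_prop, fun _ => rfl⟩

/-- The Fourier--Borel transform `z ↦ ⟨e_{-z}, φ⟩` of a continuous linear functional on
`H(S_α)`. -/
def fourierBorel {α : ℝ} (φ : holSpace α →L[ℂ] ℂ) (z : ℂ) : ℂ := φ (expNeg α z)

/-! ### Complex measures on the sector -/

/-- The integral `∫ g dμ` of a vector-valued function against a complex measure. -/
def cintegral {X E : Type*} [MeasurableSpace X] [NormedAddCommGroup E] [NormedSpace ℂ E]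
    (μ : ComplexMeasure X) (g : X → E) : E :=
  VectorMeasure.integral μ g (ContinuousLinearMap.lsmul ℝ ℂ).flip

/-- The measure `μ` belongs to `M_c(S_α)`: it vanishes off a compact subset of the open sector. -/
def HasCompactSupp {α : ℝ} (μ : ComplexMeasure (sector α)) : Prop :=
  ∃ K : Set (sector α), IsCompact K ∧ ∀ E, MeasurableSet E → Disjoint E K → μ E = 0

theorem conj_mem_sector {α : ℝ} {z : ℂ} (hz : z ∈ sector α) :
    starRingEnd ℂ z ∈ sector α := by
  refine ⟨by simpa using hz.1, ?_⟩
  rw [Complex.arg_conj]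
  split_ifs with h
  · exact h ▸ hz.2
  · simpa using hz.2

/-- Complex conjugation as a map of the sector to itself. -/
def sectorConj {α : ℝ} (z : sector α) : sector α := ⟨starRingEnd ℂ z, conj_mem_sector z.2⟩

/-- `μ` is symmetric: the measure of the complex conjugate of `E` is the conjugate of `μ E`. -/
def IsSymmetric {α : ℝ} (μ : ComplexMeasure (sector α)) : Prop :=
  ∀ E, MeasurableSet E → μ (sectorConj '' E) = starRingEnd ℂ (μ E)

/-- The functional `φ` on `H(S_α)` is induced by the measure `μ`. -/
def IsInducedBy {α : ℝ} (φ : holSpace α →L[ℂ] ℂ) (μ : ComplexMeasure (sector α)) : Prop :=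
  ∀ g : holSpace α, φ g = cintegral μ (fun ξ => (g : C(sector α, ℂ)) ξ)

/-! ### Banach algebras, possibly without unit -/

section Algebra

/-- The spectral radius of an element of a complex algebra, with or without unit.  (For an algebra
without unit the quasispectrum is the spectrum in the unitization; for a unital one it is the
spectrum together with `0`.) -/
def specRadius {A : Type*} [NonUnitalRing A] [Module ℂ A] (a : A) : ℝ≥0∞ :=
  ⨆ z ∈ quasispectrum ℂ a, ‖z‖ₑ

variable (A : Type*) [NonUnitalRing A] [Module ℂ A] [IsScalarTower ℂ A A] [SMulCommClass ℂ A A]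

/-- The (Jacobson) radical of a complex algebra `A`, with or without unit: the intersection of `A`
with the Jacobson radical of its unitization.  For commutative Banach algebras it is the set of
elements of spectral radius zero, see `mem_radical_iff`. -/
def radical : Submodule ℂ A where
  carrier := {a | (a : Unitization ℂ A) ∈ Ring.jacobson (Unitization ℂ A)}
  add_mem' := by
    intro a b ha hb
    simpa [Unitization.inr_add] using add_mem ha hb
  zero_mem' := by simp
  smul_mem' := by
    intro c a ha
    have := (Ring.jacobson (Unitization ℂ A)).mul_mem_left (algebraMap ℂ _ c) ha
    simpa [Unitization.inr_smul, Algebra.smul_def] using this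

/-- The quotient algebra `A / rad A`. -/
abbrev ModRad := A ⧸ radical A

variable {A}

theorem radical_mul_mem_left (a : A) {b : A} (hb : b ∈ radical A) : a * b ∈ radical A := by
  have := (Ring.jacobson (Unitization ℂ A)).mul_mem_left (a : Unitization ℂ A) hb
  rw [← Unitization.inr_mul] at this
  exact this

theorem radical_mul_mem_right {a : A} (b : A) (ha : a ∈ radical A) : a * b ∈ radical A := by
  have := (Ring.jacobson (Unitization ℂ A)).mul_mem_right (b : Unitization ℂ A) ha
  rw [← Unitization.inr_mul] at this
  exact this

variable (A)

/-- The canonical surjection `π : A → A / rad A`. -/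
def toModRad : A →ₗ[ℂ] ModRad A := (radical A).mkQ

instance : Mul (ModRad A) where
  mul := Quotient.map₂ (· * ·) (by
    intro a a' h b b' h'
    have h1 : a - a' ∈ radical A := (Submodule.quotientRel_def _).1 h
    have h2 : b - b' ∈ radical A := (Submodule.quotientRel_def _).1 h'
    refine (Submodule.quotientRel_def _).2 ?_
    have : a * b - a' * b' = (a - a') * b + a' * (b - b') := by
      rw [sub_mul, mul_sub]; abel
    rw [this]
    exact add_mem (radical_mul_mem_right b h1) (radical_mul_mem_left a' h2))

theorem toModRad_mul (a b : A) : toModRad A (a * b) = toModRad A a * toModRad A b := rfl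

instance : NonUnitalRing (ModRad A) where
  left_distrib := by
    rintro ⟨a⟩ ⟨b⟩ ⟨c⟩
    exact congrArg (toModRad A) (mul_add a b c)
  right_distrib := by
    rintro ⟨a⟩ ⟨b⟩ ⟨c⟩
    exact congrArg (toModRad A) (add_mul a b c)
  zero_mul := by
    rintro ⟨a⟩
    exact congrArg (toModRad A) (zero_mul a)
  mul_zero := by
    rintro ⟨a⟩
    exact congrArg (toModRad A) (mul_zero a)
  mul_assoc := by
    rintro ⟨a⟩ ⟨b⟩ ⟨c⟩
    exact congrArg (toModRad A) (mul_assoc a b c)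

end Algebra

theorem mem_jacobson_iff {U : Type*} [NormedCommRing U] [NormedAlgebra ℂ U] [CompleteSpace U]
    (x : U) : x ∈ Ring.jacobson U ↔ spectrum ℂ x ⊆ {0} := by
  rw [Ring.jacobson_eq_sInf_isMaximal, Ideal.mem_sInf]
  constructor
  · intro h z hz
    obtain ⟨f, rfl⟩ := WeakDual.CharacterSpace.mem_spectrum_iff_exists.1 hz
    have hf : Function.Surjective (f : U →+* ℂ) := fun c =>
      ⟨algebraMap ℂ U c, by simpa using AlgHomClass.commutes f c⟩
    exact h (I := RingHom.ker (f : U →+* ℂ)) (RingHom.ker_isMaximal_of_surjective _ hf)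
  · intro h M hM
    have : M.IsMaximal := hM
    by_contra hx
    obtain ⟨y, m, hm, hy⟩ := hM.exists_inv hx
    have h1 := congrArg M.toCharacterSpace hy
    have h2 : M.toCharacterSpace x = 0 :=
      h (WeakDual.CharacterSpace.mem_spectrum_iff_exists.2 ⟨_, rfl⟩)
    rw [map_add, map_mul, h2, M.toCharacterSpace_apply_eq_zero_of_mem hm] at h1
    simp at h1

/-- In a commutative complex Banach algebra the radical is the set of elements with spectral
radius zero. -/
theorem mem_radical_iff {A : Type*} [NonUnitalNormedCommRing A] [NormedSpace ℂ A]
    [IsScalarTower ℂ A A] [SMulCommClass ℂ A A] [CompleteSpace A] (a : A) :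
    a ∈ radical A ↔ specRadius a = 0 := by
  have h0 : specRadius a = 0 ↔ spectrum ℂ (a : Unitization ℂ A) ⊆ {0} := by
    simp [specRadius, Unitization.quasispectrum_eq_spectrum_inr, Set.subset_def]
  have h1 : a ∈ radical A ↔ (a : Unitization ℂ A) ∈ Ring.jacobson (Unitization ℂ A) := Iff.rfl
  let U := WithLp 1 (Unitization ℂ A)
  let : NormedCommRing U :=
    { WithLp.instUnitizationNormedRing with
      mul_comm := fun x y => WithLp.ofLp_injective 1 (mul_comm _ _) }
  let : NormedAlgebra ℂ U :=
    { (WithLp.instUnitizationNormedAlgebra : NormedAlgebra ℂ (WithLp 1 (Unitization ℂ A))) with }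
  let e : Unitization ℂ A ≃ₐ[ℂ] U := (WithLp.unitizationAlgEquiv (𝕜 := ℂ) (A := A) ℂ).symm
  have hU := mem_jacobson_iff (U := U) (e a)
  rw [AlgEquiv.spectrum_eq e] at hU
  rw [h0, h1, ← hU]
  constructor
  · intro h
    have : RingHomSurjective (e : Unitization ℂ A →+* U) := ⟨e.surjective⟩
    exact Ring.le_comap_jacobson (e : Unitization ℂ A →+* U) h
  · intro h
    have : RingHomSurjective (e.symm : U →+* Unitization ℂ A) := ⟨e.symm.surjective⟩
    have := Ring.le_comap_jacobson (e.symm : U →+* Unitization ℂ A) h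
    simpa using this

/-- `e` is a two-sided identity element. -/
def IsIdentity {R : Type*} [Mul R] (e : R) : Prop := ∀ x, e * x = x ∧ x * e = x

/-- Powers `u ^ k` in an algebra with identity element `e` (so that `u ^ 0 = e`). -/
def powWith {R : Type*} [Mul R] (e u : R) : ℕ → R
  | 0 => e
  | k + 1 => powWith e u k * u

/-! ### Analytic semigroups -/

section Semigroup

variable {B : Type*} [NonUnitalNormedRing B] [NormedSpace ℂ B] [IsScalarTower ℂ B B]
  [SMulCommClass ℂ B B]

/-- `(T(t))_{t ∈ S_α}` is an analytic semigroup in the Banach algebra `B` (the values of `T` off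
the sector are irrelevant). -/
structure IsAnalyticSemigroup (α : ℝ) (T : ℂ → B) : Prop where
  differentiableOn : DifferentiableOn ℂ T (sector α)
  map_add : ∀ s ∈ sector α, ∀ t ∈ sector α, T (s + t) = T s * T t

/-- All elements of the semigroup have spectral radius zero. -/
def IsQuasinilpotent (α : ℝ) (T : ℂ → B) : Prop := ∀ t ∈ sector α, specRadius (T t) = 0

/-- The closed subalgebra of `B` generated by `(T(t))_{t ∈ S_α}`; it need not contain a unit. -/
def semigroupAlgebra (α : ℝ) (T : ℂ → B) : NonUnitalSubalgebra ℂ B :=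
  (NonUnitalAlgebra.adjoin ℂ (T '' sector α)).topologicalClosure

theorem mem_semigroupAlgebra {α : ℝ} (T : ℂ → B) {t : ℂ} (ht : t ∈ sector α) :
    T t ∈ semigroupAlgebra α T :=
  NonUnitalSubalgebra.le_topologicalClosure _
    (NonUnitalAlgebra.subset_adjoin ℂ (Set.mem_image_of_mem T ht))

/-- The class `π(T(t))` in the quotient of the generated algebra by its radical. -/
def classOf {α : ℝ} (T : ℂ → B) (t : sector α) : ModRad (semigroupAlgebra α T) :=
  toModRad _ ⟨T t, mem_semigroupAlgebra T t.2⟩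

/-- For an analytic semigroup `T(t) = exp(tA)` and the Fourier--Borel transform `f` of (the
functional induced by) `μ`, the element `f(-tA) = ∫ T(tξ) dμ(ξ)`, for `t > 0`. -/
def funcCalc {α : ℝ} (μ : ComplexMeasure (sector α)) (T : ℂ → B) (t : ℝ) : B :=
  cintegral μ (fun ξ => T (t * ξ))

/-- The identity `e` and the element `u` exhibit a bounded generator of `(π(T(t)))_{t ∈ S_α}`:
`π(T(t)) = exp(tu) = e + ∑_{k ≥ 1} (tu)^k / k!` for all `t ∈ S_α`, with convergence in the quotient
norm. -/
def IsBoundedGenerator {α : ℝ} (T : ℂ → B) (e u : ModRad (semigroupAlgebra α T)) : Prop :=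
  ∀ t : sector α,
    HasSum (fun k : ℕ => ((t : ℂ) ^ k / (k.factorial : ℂ)) • powWith e u k) (classOf T t)

end Semigroup

/-- The supremum of `|f(x)|` over `x > 0`. -/
def supOnPos (f : ℂ → ℂ) : ℝ≥0∞ := ⨆ x : ℝ, ⨆ _ : 0 < x, ‖f x‖ₑ

/-- The semigroup `T(t) : x ↦ x ^ t`, for `Re t > 0`, in the Banach algebra `C₀([0,1])` of
continuous functions on `[0,1]` that vanish at `0`. -/
def powSemigroup (t : ℂ) : ContinuousMapZero unitInterval ℂ :=
  if ht : 0 < t.re then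
    { toFun := fun x => ((x : ℝ) : ℂ) ^ t
      continuous_toFun := continuous_iff_continuousAt.2 fun x =>
        (Complex.continuousAt_ofReal_cpow_const (x : ℝ) t (Or.inl ht)).comp
          continuous_subtype_val.continuousAt
      map_zero' := by
        have : t ≠ 0 := by rintro rfl; simp at ht
        simp [Complex.zero_cpow this] }
  else 0

end SectorSemigroup

end

/-!
A multiplicative functional on the generated algebra that does not kill the semigroup turns `T t`
into `exp (t c)` for some `c : ℂ`, and `f(-tA)` into `f (-t c)`. If `-c` lies well inside the dual
cone of the support of `μ`, which holds for all large `c`, then `f` decays exponentially on the cone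
spanned by `-c` and its conjugate; as `f 0 = 0` and `|f (z̄)| = |f z|`, the maximum principle there
makes `|f (-t c)|` reach `sup_{x > 0} |f x|` at some `t` with `t |c| ≤ R`. The strict inequality in
(1) therefore bounds the exponents `c`. Then for small `r > 0` every multiplicative functional takes
a value near `0` or `1` at `T r`, so the algebra contains an idempotent `p` that is an identity
modulo the radical, and `T t p + (1 - p)` is a semigroup of invertible elements of the unitization,
hence of the form `exp (t v)`.

For the semigroup of powers the evaluations give the exponents `c = log x`, so that `-t c` runs
through all of `[0, ∞)`.
-/

namespace SectorSemigroup

section Integration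

variable {X E F : Type*} [MeasurableSpace X] [NormedAddCommGroup E] [NormedSpace ℂ E]
  [NormedAddCommGroup F] [NormedSpace ℂ F] {μ : ComplexMeasure X}

instance isFiniteMeasure_variation (μ : ComplexMeasure X) : IsFiniteMeasure μ.variation := by
  refine isFiniteMeasure_of_le ((ComplexMeasure.re μ).totalVariation +
    (ComplexMeasure.im μ).totalVariation)
    (VectorMeasure.variation_le_of_forall_enorm_le fun E _ => ?_)
  calc ‖μ E‖ₑ
      = ‖((ComplexMeasure.re μ E : ℝ) : ℂ) + (ComplexMeasure.im μ E : ℝ) * Complex.I‖ₑ :=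
        congrArg enorm (Complex.re_add_im (μ E)).symm
    _ ≤ ‖((ComplexMeasure.re μ E : ℝ) : ℂ)‖ₑ + ‖((ComplexMeasure.im μ E : ℝ) : ℂ) * Complex.I‖ₑ :=
        enorm_add_le _ _
    _ = ‖ComplexMeasure.re μ E‖ₑ + ‖ComplexMeasure.im μ E‖ₑ := by simp [← ofReal_norm]
    _ ≤ _ := add_le_add (SignedMeasure.enorm_le_totalVariation _ _)
        (SignedMeasure.enorm_le_totalVariation _ _)

theorem cintegral_sub {g h : X → E} (hg : Integrable g μ.variation)
    (hh : Integrable h μ.variation) :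
    cintegral μ (fun x => g x - h x) = cintegral μ g - cintegral μ h :=
  VectorMeasure.integral_fun_sub hg hh

theorem cintegral_one : cintegral μ (fun _ => (1 : ℂ)) = μ univ :=
  (VectorMeasure.integral_const _).trans (by simp)

theorem norm_cintegral_le {g : X → E} {C : ℝ} (hC₀ : 0 ≤ C)
    (hC : ∀ᵐ x ∂μ.variation, ‖g x‖ ≤ C) : ‖cintegral μ g‖ ≤ C * μ.variation.real univ := by
  refine (VectorMeasure.norm_integral_le_of_norm_le_const hC).trans ?_
  refine mul_le_mul_of_nonneg_right (mul_le_of_le_one_right hC₀ ?_) measureReal_nonneg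
  rw [ContinuousLinearMap.opNorm_flip]
  exact ContinuousLinearMap.opNorm_lsmul_le

theorem map_cintegral [CompleteSpace E] [CompleteSpace F] (L : E →L[ℂ] F) {g : X → E}
    (hg : Integrable g μ.variation) : L (cintegral μ g) = cintegral μ fun x => L (g x) := by
  have h_out := VectorMeasure.continuousLinearMap_apply_integral
    (B := (ContinuousLinearMap.lsmul ℝ ℂ (E := E)).flip) (C := L.restrictScalars ℝ) hg
  have h_in := VectorMeasure.integral_continuousLinearMap_comp
    (B := (ContinuousLinearMap.lsmul ℝ ℂ (E := F)).flip) (C := L.restrictScalars ℝ) hg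
  refine h_out.trans (Eq.trans ?_ h_in.symm)
  congr 1
  ext x c
  simp

theorem cintegral_const_smul [CompleteSpace E] (c : ℂ) {g : X → E}
    (hg : Integrable g μ.variation) :
    cintegral μ (fun x => c • g x) = c • cintegral μ g :=
  (map_cintegral (c • ContinuousLinearMap.id ℂ E) hg).symm

theorem integrable_of_ae_mem_isCompact [TopologicalSpace X] [OpensMeasurableSpace X]
    [SecondCountableTopology X] {V : Type*} [NormedAddCommGroup V] {K : Set X} (hK : IsCompact K)
    (hμK : ∀ᵐ x ∂μ.variation, x ∈ K) {g : X → V} (hg : Continuous g) :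
    Integrable g μ.variation := by
  obtain ⟨C, hC⟩ := hK.exists_bound_of_continuousOn hg.continuousOn
  exact Integrable.of_bound hg.aestronglyMeasurable C (hμK.mono hC)

theorem hasDerivAt_of_norm_sub_le_sq {F : ℂ → E} {D : E} {z : ℂ} {C δ : ℝ} (hδ : 0 < δ)
    (h : ∀ w : ℂ, ‖w‖ < δ → ‖F (z + w) - F z - w • D‖ ≤ C * ‖w‖ ^ 2) : HasDerivAt F D z := by
  rw [hasDerivAt_iff_isLittleO_nhds_zero]
  have h_sq : (fun w : ℂ => F (z + w) - F z - w • D) =O[𝓝 0] fun w : ℂ => w ^ 2 := by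
    refine Asymptotics.IsBigO.of_bound C ?_
    filter_upwards [Metric.ball_mem_nhds (0 : ℂ) hδ] with w hw
    simpa using h w (by simpa using hw)
  refine h_sq.trans_isLittleO ?_
  simpa using Asymptotics.isLittleO_pow_pow (𝕜 := ℂ) one_lt_two

theorem hasDerivAt_cintegral [CompleteSpace E] {G : ℂ → X → E} {G' : X → E} {z : ℂ} {C δ : ℝ}
    (hC : 0 ≤ C) (hδ : 0 < δ) (hG : ∀ w, Integrable (G w) μ.variation)
    (hG' : Integrable G' μ.variation)
    (h : ∀ w : ℂ, ‖w‖ < δ →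
      ∀ᵐ x ∂μ.variation, ‖G (z + w) x - G z x - w • G' x‖ ≤ C * ‖w‖ ^ 2) :
    HasDerivAt (fun w => cintegral μ (G w)) (cintegral μ G') z := by
  refine hasDerivAt_of_norm_sub_le_sq (C := C * μ.variation.real univ) hδ fun w hw => ?_
  rw [← cintegral_sub (hG _) (hG _), ← cintegral_const_smul _ hG',
    ← cintegral_sub ((hG _).sub' (hG _)) (hG'.fun_smul w)]
  exact (norm_cintegral_le (by positivity) (h w hw)).trans (le_of_eq (by ring))

end Integration

section Sector

variable {α : ℝ}

theorem mem_sector_iff_abs_im_lt (hα₀ : 0 < α) (hα₁ : α < Real.pi / 2) {z : ℂ} :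
    z ∈ sector α ↔ 0 < z.re ∧ |z.im| < Real.tan α * z.re := by
  refine and_congr_right fun hz => ?_
  have harg : z.arg ∈ Ioo (-(Real.pi / 2)) (Real.pi / 2) :=
    abs_lt.1 (Complex.abs_arg_lt_pi_div_two_iff.2 (Or.inl hz))
  have hα : α ∈ Ioo (-(Real.pi / 2)) (Real.pi / 2) := ⟨by linarith, hα₁⟩
  have hnegα : -α ∈ Ioo (-(Real.pi / 2)) (Real.pi / 2) := ⟨by linarith, by linarith⟩
  rw [abs_lt, ← Real.strictMonoOn_tan.lt_iff_lt hnegα harg,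
    ← Real.strictMonoOn_tan.lt_iff_lt harg hα, Real.tan_neg, ← abs_lt, Complex.tan_arg, abs_div,
    abs_of_pos hz, div_lt_iff₀ hz]

theorem isOpen_sector : IsOpen (sector α) := by
  have hcont : ContinuousOn (fun z : ℂ => |z.arg|) {z : ℂ | 0 < z.re} := fun z hz =>
    (Complex.continuousAt_arg (Or.inl hz)).abs.continuousWithinAt
  exact hcont.isOpen_inter_preimage (isOpen_lt continuous_const Complex.continuous_re) isOpen_Iio

theorem add_mem_sector {s t : ℂ} (hs : s ∈ sector α) (ht : t ∈ sector α) : s + t ∈ sector α := by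
  have hα₀ : 0 < α := (abs_nonneg _).trans_lt hs.2
  have hre : 0 < (s + t).re := add_pos hs.1 ht.1
  rcases le_or_gt (Real.pi / 2) α with hα | hα
  · exact ⟨hre, (Complex.abs_arg_lt_pi_div_two_iff.2 (Or.inl hre)).trans_le hα⟩
  · rw [mem_sector_iff_abs_im_lt hα₀ hα] at *
    refine ⟨hre, ?_⟩
    rw [Complex.add_im, Complex.add_re]
    linarith [abs_add_le s.im t.im]

theorem ofReal_mul_mem_sector {r : ℝ} (hr : 0 < r) {t : ℂ} (ht : t ∈ sector α) :
    (r : ℂ) * t ∈ sector α := by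
  refine ⟨?_, ?_⟩
  · rw [Complex.re_ofReal_mul]
    exact mul_pos hr ht.1
  · rw [Complex.arg_real_mul _ hr]
    exact ht.2

theorem ofReal_mem_sector (hα₀ : 0 < α) {r : ℝ} (hr : 0 < r) : (r : ℂ) ∈ sector α :=
  ⟨by simpa using hr, by rwa [Complex.arg_ofReal_of_nonneg hr.le, abs_zero]⟩

theorem convex_sector : Convex ℝ (sector α) := by
  refine convex_iff_forall_pos.2 fun x hx y hy a b ha hb _ => ?_
  simp only [Complex.real_smul]
  exact add_mem_sector (ofReal_mul_mem_sector ha hx) (ofReal_mul_mem_sector hb hy)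

theorem HasCompactSupp.exists_isCompact_ae_mem {μ : ComplexMeasure (sector α)}
    (hμ : HasCompactSupp μ) :
    ∃ K : Set (sector α), IsCompact K ∧ ∀ᵐ ξ ∂μ.variation, ξ ∈ K := by
  obtain ⟨K, hK, hμK⟩ := hμ
  refine ⟨K, hK, (VectorMeasure.variation_apply_eq_zero hK.isClosed.measurableSet.compl).2
    fun E hE hEm => hμK E hEm (disjoint_left.2 fun x hx hxK => hE hx hxK)⟩

theorem HasCompactSupp.exists_isCompact_conj_stable (hα₀ : 0 < α) {μ : ComplexMeasure (sector α)}
    (hμ : HasCompactSupp μ) :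
    ∃ K : Set (sector α), IsCompact K ∧ K.Nonempty ∧ (∀ ξ ∈ K, sectorConj ξ ∈ K) ∧
      ∀ᵐ ξ ∂μ.variation, ξ ∈ K := by
  obtain ⟨K, hK, hμK⟩ := hμ.exists_isCompact_ae_mem
  have hconj : Continuous (sectorConj : sector α → sector α) :=
    (Complex.continuous_conj.comp continuous_subtype_val).subtype_mk _
  have hone : ((1 : ℝ) : ℂ) ∈ sector α := ofReal_mem_sector hα₀ one_pos
  set K₁ : Set (sector α) := insert ⟨_, hone⟩ K
  refine ⟨K₁ ∪ sectorConj '' K₁, (hK.insert _).union ((hK.insert _).image hconj),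
    ⟨_, Or.inl (mem_insert _ _)⟩, ?_, hμK.mono fun ξ hξ => Or.inl (mem_insert_of_mem _ hξ)⟩
  rintro _ (hξ | ⟨ξ, hξ, rfl⟩)
  · exact Or.inr (mem_image_of_mem _ hξ)
  · refine Or.inl ?_
    rwa [show sectorConj (sectorConj ξ) = ξ from Subtype.ext (Complex.conj_conj _)]

end Sector

section Laplace

variable {α : ℝ} {μ : ComplexMeasure (sector α)}

/-- The Laplace transform `z ↦ ∫ exp (-z ξ) dμ(ξ)` of a measure on the sector: the Fourier--Borel
transform of the functional that the measure induces. -/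
noncomputable def laplace (μ : ComplexMeasure (sector α)) (z : ℂ) : ℂ :=
  cintegral μ fun ξ => Complex.exp (-z * ξ)

theorem IsInducedBy.fourierBorel_eq_laplace {φ : holSpace α →L[ℂ] ℂ} (h : IsInducedBy φ μ) :
    fourierBorel φ = laplace μ :=
  funext fun z => h (expNeg α z)

theorem laplace_zero : laplace μ 0 = μ univ := by
  simp [laplace, cintegral_one]

theorem norm_laplace_le {z : ℂ} {m : ℝ} (hm : ∀ᵐ ξ : sector α ∂μ.variation, m ≤ (z * ξ).re) :
    ‖laplace μ z‖ ≤ Real.exp (-m) * μ.variation.real univ := by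
  refine norm_cintegral_le (Real.exp_pos _).le (hm.mono fun ξ hξ => ?_)
  rw [Complex.norm_exp, neg_mul, Complex.neg_re]
  gcongr

theorem supOnPos_laplace_lt_top : supOnPos (laplace μ) < ∞ := by
  refine (iSup₂_le fun x hx => ?_).trans_lt (ENNReal.ofReal_lt_top (r := μ.variation.real univ))
  rw [← ofReal_norm]
  refine ENNReal.ofReal_le_ofReal ((norm_laplace_le (m := 0) (.of_forall fun ξ => ?_)).trans ?_)
  · rw [Complex.re_ofReal_mul]
    exact mul_nonneg hx.le ξ.2.1.le
  · simp

theorem norm_exp_add_sub_exp_sub_le {R : ℝ} {z w ξ : ℂ} (hξ : ‖ξ‖ ≤ R) (hw : R * ‖w‖ ≤ 1) :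
    ‖Complex.exp (-(z + w) * ξ) - Complex.exp (-z * ξ) - w • (-ξ * Complex.exp (-z * ξ))‖ ≤
      ‖Complex.exp (-z * ξ)‖ * R ^ 2 * ‖w‖ ^ 2 := by
  have hfactor : Complex.exp (-(z + w) * ξ) - Complex.exp (-z * ξ)
      - w • (-ξ * Complex.exp (-z * ξ)) =
      Complex.exp (-z * ξ) * (Complex.exp (-w * ξ) - 1 - -w * ξ) := by
    rw [show -(z + w) * ξ = -z * ξ + -w * ξ by ring, Complex.exp_add, smul_eq_mul]
    ring
  have hwξ : ‖-w * ξ‖ ≤ R * ‖w‖ := by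
    rw [norm_mul, norm_neg, mul_comm]
    gcongr
  rw [hfactor, norm_mul, mul_assoc, ← mul_pow]
  gcongr
  exact (Complex.norm_exp_sub_one_sub_id_le (hwξ.trans hw)).trans (by gcongr)

theorem differentiable_laplace (hμ : HasCompactSupp μ) : Differentiable ℂ (laplace μ) := by
  intro z
  obtain ⟨K, hK, hμK⟩ := hμ.exists_isCompact_ae_mem
  obtain ⟨R, hR⟩ := hK.exists_bound_of_continuousOn (f := fun ξ : sector α => (ξ : ℂ))
    continuous_subtype_val.continuousOn
  obtain ⟨C, hC⟩ := hK.exists_bound_of_continuousOn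
    (f := fun ξ : sector α => Complex.exp (-z * ξ)) (by fun_prop)
  have hintegrable (g : sector α → ℂ) (hg : Continuous g) : Integrable g μ.variation :=
    integrable_of_ae_mem_isCompact hK hμK hg
  refine (hasDerivAt_cintegral (C := |C| * (|R| + 1) ^ 2) (δ := (|R| + 1)⁻¹)
    (G' := fun ξ : sector α => -(ξ : ℂ) * Complex.exp (-z * ξ)) (by positivity) (by positivity)
    (fun w => hintegrable _ (by fun_prop)) (hintegrable _ (by fun_prop)) fun w hw =>
      hμK.mono fun ξ hξ => ?_).differentiableAt
  refine (norm_exp_add_sub_exp_sub_le (R := |R| + 1) ?_ ?_).trans ?_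
  · linarith [hR ξ hξ, le_abs_self R]
  · exact (mul_le_mul_of_nonneg_left hw.le (by positivity)).trans_eq
      (mul_inv_cancel₀ (by positivity))
  · gcongr
    exact (hC ξ hξ).trans (le_abs_self C)

end Laplace

section MaximumPrinciple

theorem conj_apply_of_im_eq_zero_on_pos {f : ℂ → ℂ} (hf : Differentiable ℂ f)
    (hreal : ∀ x : ℝ, 0 < x → (f x).im = 0) (z : ℂ) :
    f (starRingEnd ℂ z) = starRingEnd ℂ (f z) := by
  set g : ℂ → ℂ := fun z => starRingEnd ℂ (f (starRingEnd ℂ z))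
  have hg : Differentiable ℂ g := fun z => by
    have := (hf (starRingEnd ℂ z)).conj_conj
    rwa [Complex.conj_conj] at this
  have hfg : f = g := by
    refine AnalyticOnNhd.eq_of_frequently_eq (𝕜 := ℂ) (z₀ := 1) (fun x _ => hf.analyticAt x)
      (fun x _ => hg.analyticAt x) ?_
    have hlim : Tendsto ((↑) : ℝ → ℂ) (𝓝[>] 1) (𝓝[≠] 1) := by
      refine tendsto_nhdsWithin_iff.2 ⟨?_, ?_⟩
      · exact (Complex.continuous_ofReal.tendsto' 1 1 Complex.ofReal_one).mono_left
          nhdsWithin_le_nhds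
      · filter_upwards [self_mem_nhdsWithin] with x hx
        simpa using ne_of_gt hx
    refine hlim.frequently (Eventually.frequently ?_)
    filter_upwards [self_mem_nhdsWithin] with x hx
    simp only [g, Complex.conj_ofReal]
    exact (Complex.conj_eq_iff_im.2 (hreal x (one_pos.trans hx))).symm
  simpa [g] using congrFun hfg (starRingEnd ℂ z)

/-- The closed convex cone `{a z + b z̄ : a, b ≥ 0}` spanned by `z` and its conjugate, for
`Re z > 0`, described by inequalities. -/
def conjCone (z : ℂ) : Set ℂ := {w | 0 ≤ w.re ∧ |w.im| * z.re ≤ |z.im| * w.re}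

variable {z w : ℂ}

theorem isClosed_conjCone : IsClosed (conjCone z) :=
  isClosed_le continuous_const Complex.continuous_re |>.inter <|
    isClosed_le (f := fun w : ℂ => |w.im| * z.re) (by fun_prop) (by fun_prop)

theorem ofReal_mem_conjCone {x : ℝ} (hx : 0 ≤ x) : (x : ℂ) ∈ conjCone z := by
  refine ⟨by simpa using hx, ?_⟩
  simpa using mul_nonneg (abs_nonneg z.im) hx

theorem ofReal_mul_mem_conjCone (hz : 0 < z.re) {t : ℝ} (ht : 0 ≤ t) :
    (t : ℂ) * z ∈ conjCone z := by
  refine ⟨by simpa using mul_nonneg ht hz.le, le_of_eq ?_⟩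
  rw [Complex.re_ofReal_mul, Complex.im_ofReal_mul, abs_mul, abs_of_nonneg ht]
  ring

theorem exists_eq_ofReal_mul_of_eq (hz : 0 < z.re) (hw₀ : 0 ≤ w.re)
    (hw : |w.im| * z.re = |z.im| * w.re) :
    ∃ t : ℝ, 0 ≤ t ∧ (w = t * z ∨ w = starRingEnd ℂ (t * z)) := by
  have ht : 0 ≤ w.re / z.re := by positivity
  have him : |w.im| = |w.re / z.re * z.im| := by
    rw [abs_mul, abs_of_nonneg ht]
    field_simp
    linarith
  refine ⟨w.re / z.re, ht, (abs_eq_abs.1 him).imp (fun h => Complex.ext ?_ ?_)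
    fun h => Complex.ext ?_ ?_⟩
  all_goals simp only [Complex.conj_re, Complex.conj_im, Complex.re_ofReal_mul,
    Complex.im_ofReal_mul, h]
  all_goals field_simp

theorem exists_eq_add_of_mem_conjCone (hz : 0 < z.re) (hw : w ∈ conjCone z) :
    ∃ a b : ℝ, 0 ≤ a ∧ 0 ≤ b ∧ w = a * z + b * starRingEnd ℂ z := by
  obtain ⟨hw₀, hw⟩ := hw
  rcases hw.eq_or_lt with hw | hw
  · obtain ⟨t, ht, h | h⟩ := exists_eq_ofReal_mul_of_eq hz hw₀ hw
    · exact ⟨t, 0, ht, le_rfl, by simpa using h⟩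
    · exact ⟨0, t, le_rfl, ht, by simpa using h⟩
  · have hzi : 0 < |z.im| := by
      refine (abs_nonneg _).lt_of_ne fun h => ?_
      rw [← h, zero_mul] at hw
      exact hw.not_ge (by positivity)
    have hzi' : z.im ≠ 0 := abs_pos.1 hzi
    have hslope : |w.im / z.im| ≤ w.re / z.re := by
      rw [abs_div, div_le_div_iff₀ hzi hz]
      linarith
    obtain ⟨hlo, hhi⟩ := abs_le.1 hslope
    refine ⟨(w.re / z.re + w.im / z.im) / 2, (w.re / z.re - w.im / z.im) / 2, by linarith,
      by linarith, Complex.ext ?_ ?_⟩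
    · simp
      field_simp
      ring
    · simp
      field_simp
      ring

theorem norm_le_on_conjCone {f : ℂ → ℂ} (hf : Differentiable ℂ f) (hz : 0 < z.re) {m R : ℝ}
    (hray : ∀ t : ℝ, 0 ≤ t → ‖f (t * z)‖ ≤ m ∧ ‖f (starRingEnd ℂ (t * z))‖ ≤ m)
    (hfar : ∀ w ∈ conjCone z, R ≤ ‖w‖ → ‖f w‖ ≤ m) (hw : w ∈ conjCone z) : ‖f w‖ ≤ m := by
  set U : Set ℂ := {w | |w.im| * z.re < |z.im| * w.re} ∩ Metric.ball 0 R
  have hU : IsOpen U := (isOpen_lt (by fun_prop) (by fun_prop)).inter Metric.isOpen_ball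
  have hUcone : closure U ⊆ conjCone z := by
    refine closure_minimal (fun v hv => ⟨?_, hv.1.le⟩) isClosed_conjCone
    exact (pos_of_mul_pos_right ((by positivity : 0 ≤ |v.im| * z.re).trans_lt hv.1)
      (abs_nonneg _)).le
  have hout : ∀ v ∈ conjCone z, v ∉ U → ‖f v‖ ≤ m := by
    intro v hv hvU
    by_cases hvR : R ≤ ‖v‖
    · exact hfar v hv hvR
    · have hve : |v.im| * z.re = |z.im| * v.re := by
        refine hv.2.eq_of_not_lt fun h => hvU ⟨h, ?_⟩
        simpa using hvR
      obtain ⟨t, ht, rfl | rfl⟩ := exists_eq_ofReal_mul_of_eq hz hv.1 hve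
      exacts [(hray t ht).1, (hray t ht).2]
  by_cases hwU : w ∈ U
  · refine Complex.norm_le_of_forall_mem_frontier_norm_le
      (Metric.isBounded_ball.subset inter_subset_right) hf.diffContOnCl (fun v hv => ?_)
      (subset_closure hwU)
    exact hout v (hUcone (frontier_subset_closure hv)) (hU.frontier_eq ▸ hv).2
  · exact hout w hw hwU

theorem exists_lt_forall_le_of_eventually_le {g : ℝ → ℝ} (hg : Continuous g) {m M : ℝ}
    (hM : ∀ t, 0 ≤ t → g t < M) (hm : m < M) (hfar : ∀ᶠ t in atTop, g t ≤ m) :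
    ∃ m' < M, ∀ t, 0 ≤ t → g t ≤ m' := by
  obtain ⟨R, hR⟩ := eventually_atTop.1 hfar
  obtain ⟨t₀, ht₀, hmax⟩ := (isCompact_Icc (a := 0) (b := |R|)).exists_isMaxOn
    ⟨0, left_mem_Icc.2 (abs_nonneg R)⟩ hg.continuousOn
  refine ⟨max (g t₀) m, max_lt (hM t₀ ht₀.1) hm, fun t ht => ?_⟩
  rcases le_total t |R| with htR | htR
  · exact (hmax ⟨ht, htR⟩).trans (le_max_left _ _)
  · exact (hR t ((le_abs_self R).trans htR)).trans (le_max_right _ _)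

theorem exists_le_norm_on_ray {f : ℂ → ℂ} (hf : Differentiable ℂ f)
    (hconj : ∀ w, ‖f (starRingEnd ℂ w)‖ = ‖f w‖) {m M R : ℝ} (hf₀ : ‖f 0‖ < M) (hm : m < M)
    (hsup : ∀ m' < M, ∃ x : ℝ, 0 < x ∧ m' < ‖f x‖) (hz : 0 < z.re)
    (hfar : ∀ w ∈ conjCone z, R ≤ ‖w‖ → ‖f w‖ ≤ m) :
    ∃ t : ℝ, 0 < t ∧ t * ‖z‖ < R ∧ M ≤ ‖f (t * z)‖ := by
  by_contra! hlt
  have hz₀ : 0 < ‖z‖ := hz.trans_le (Complex.re_le_norm z)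
  have hnorm {t : ℝ} (ht : 0 ≤ t) : ‖(t : ℂ) * z‖ = t * ‖z‖ := by
    rw [norm_mul, Complex.norm_real, Real.norm_of_nonneg ht]
  have hfar_ray {t : ℝ} (ht : 0 ≤ t) (htR : R ≤ t * ‖z‖) : ‖f (t * z)‖ ≤ m :=
    hfar _ (ofReal_mul_mem_conjCone hz ht) (by rwa [hnorm ht])
  have hray (t : ℝ) (ht : 0 ≤ t) : ‖f (t * z)‖ < M := by
    rcases ht.eq_or_lt with rfl | ht'
    · simpa using hf₀
    · rcases lt_or_ge (t * ‖z‖) R with htR | htR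
      exacts [hlt t ht' htR, (hfar_ray ht htR).trans_lt hm]
  obtain ⟨m', hm', hm'_le⟩ := exists_lt_forall_le_of_eventually_le
    (g := fun t : ℝ => ‖f (t * z)‖) (hf.continuous.comp (by fun_prop)).norm hray hm <| by
      filter_upwards [eventually_ge_atTop 0, eventually_ge_atTop (R / ‖z‖)] with t ht htR
      exact hfar_ray ht ((div_le_iff₀ hz₀).1 htR)
  obtain ⟨x, hx, hfx⟩ := hsup (max m' m) (max_lt hm' hm)
  refine hfx.not_ge (norm_le_on_conjCone hf hz (fun t ht => ?_)
    (fun w hw hwR => (hfar w hw hwR).trans (le_max_right _ _)) (ofReal_mem_conjCone hx.le))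
  rw [hconj, and_self]
  exact (hm'_le t ht).trans (le_max_left _ _)

end MaximumPrinciple

section LaplaceGrowth

variable {z w : ℂ} {κ : ℝ}

theorem mul_norm_le_re_mul_of_mem_conjCone {ξ : ℂ} (hκ : 0 ≤ κ) (hz : 0 < z.re)
    (hw : w ∈ conjCone z) (hξ : κ * ‖z‖ ≤ (z * ξ).re)
    (hξ' : κ * ‖z‖ ≤ (z * starRingEnd ℂ ξ).re) : κ * ‖w‖ ≤ (w * ξ).re := by
  obtain ⟨a, b, ha, hb, rfl⟩ := exists_eq_add_of_mem_conjCone hz hw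
  have hnorm : ‖(a : ℂ) * z + b * starRingEnd ℂ z‖ ≤ a * ‖z‖ + b * ‖z‖ := by
    refine (norm_add_le _ _).trans_eq ?_
    simp [abs_of_nonneg ha, abs_of_nonneg hb]
  calc κ * ‖(a : ℂ) * z + b * starRingEnd ℂ z‖ ≤ κ * (a * ‖z‖ + b * ‖z‖) := by gcongr
    _ = a * (κ * ‖z‖) + b * (κ * ‖z‖) := by ring
    _ ≤ a * (z * ξ).re + b * (z * starRingEnd ℂ ξ).re := by gcongr
    _ = (((a : ℂ) * z + b * starRingEnd ℂ z) * ξ).re := by simp; ring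

theorem re_pos_of_re_mul_pos {ξ : ℂ} (hξ : 0 < ξ.re) (h : 0 < (z * ξ).re)
    (hconj : 0 < (z * starRingEnd ℂ ξ).re) : 0 < z.re := by
  have hsum : (z * ξ).re + (z * starRingEnd ℂ ξ).re = 2 * ξ.re * z.re := by
    simp only [Complex.mul_re, Complex.conj_re, Complex.conj_im]
    ring
  exact pos_of_mul_pos_right (hsum ▸ add_pos h hconj) (by positivity)

variable {α : ℝ} {μ : ComplexMeasure (sector α)} {K : Set (sector α)}

theorem norm_laplace_le_of_mem_conjCone (hKconj : ∀ ξ ∈ K, sectorConj ξ ∈ K)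
    (hμK : ∀ᵐ ξ ∂μ.variation, ξ ∈ K) (hκ : 0 ≤ κ) (hz : 0 < z.re)
    (hzK : ∀ ξ ∈ K, κ * ‖z‖ ≤ (z * ξ).re) (hw : w ∈ conjCone z) :
    ‖laplace μ w‖ ≤ Real.exp (-(κ * ‖w‖)) * μ.variation.real univ :=
  norm_laplace_le <| hμK.mono fun ξ hξ =>
    mul_norm_le_re_mul_of_mem_conjCone hκ hz hw (hzK ξ hξ) (hzK _ (hKconj ξ hξ))

theorem exists_lt_norm_laplace_of_lt_supOnPos {m : ℝ} (hm : m < (supOnPos (laplace μ)).toReal) :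
    ∃ x : ℝ, 0 < x ∧ m < ‖laplace μ x‖ := by
  by_contra! hle
  have hm₀ : 0 ≤ m := (norm_nonneg _).trans (hle 1 one_pos)
  refine hm.not_ge (ENNReal.toReal_le_of_le_ofReal hm₀ (iSup₂_le fun x hx => ?_))
  rw [← ofReal_norm]
  exact ENNReal.ofReal_le_ofReal (hle x hx)

theorem exists_radius_forall_supOnPos_le (hμ : HasCompactSupp μ) (hμ₀ : μ univ = 0)
    (hreal : ∀ x : ℝ, 0 < x → (laplace μ x).im = 0) (hpos : 0 < supOnPos (laplace μ))
    (hKne : K.Nonempty) (hKconj : ∀ ξ ∈ K, sectorConj ξ ∈ K)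
    (hμK : ∀ᵐ ξ ∂μ.variation, ξ ∈ K) (hκ : 0 < κ) :
    ∃ R : ℝ, 0 < R ∧ ∀ z : ℂ, z ≠ 0 → (∀ ξ ∈ K, κ * ‖z‖ ≤ (z * ξ).re) →
      ∃ t : ℝ, 0 < t ∧ t * ‖z‖ < R ∧ supOnPos (laplace μ) ≤ ‖laplace μ (t * z)‖ₑ := by
  set M := (supOnPos (laplace μ)).toReal
  have hM : 0 < M := ENNReal.toReal_pos hpos.ne' supOnPos_laplace_lt_top.ne
  obtain ⟨R, hRM, hR⟩ :
      ∃ R : ℝ, Real.exp (-(κ * R)) * μ.variation.real univ ≤ M / 2 ∧ 0 < R := by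
    have hlim := (Real.tendsto_exp_neg_atTop_nhds_zero.comp
      (tendsto_id.const_mul_atTop hκ)).mul_const (μ.variation.real univ)
    rw [zero_mul] at hlim
    exact ((hlim.eventually (ge_mem_nhds (half_pos hM))).and (eventually_gt_atTop 0)).exists
  refine ⟨R, hR, fun z hz hzK => ?_⟩
  have hzre : 0 < z.re := by
    obtain ⟨ξ, hξ⟩ := hKne
    have hκz : 0 < κ * ‖z‖ := mul_pos hκ (norm_pos_iff.2 hz)
    exact re_pos_of_re_mul_pos ξ.2.1 (hκz.trans_le (hzK ξ hξ))
      (hκz.trans_le (hzK _ (hKconj ξ hξ)))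
  have hf := differentiable_laplace hμ
  obtain ⟨t, ht, htR, hMt⟩ := exists_le_norm_on_ray hf
    (fun w => by rw [conj_apply_of_im_eq_zero_on_pos hf hreal, RCLike.norm_conj])
    (by rwa [laplace_zero, hμ₀, norm_zero]) (half_lt_self hM)
    (fun m hm => exists_lt_norm_laplace_of_lt_supOnPos hm) hzre (fun w hw hwR =>
      (norm_laplace_le_of_mem_conjCone hKconj hμK hκ.le hzre hzK hw).trans
        (le_trans (by gcongr) hRM))
  refine ⟨t, ht, htR, ?_⟩
  rw [← ofReal_norm, ← ENNReal.ofReal_toReal supOnPos_laplace_lt_top.ne]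
  exact ENNReal.ofReal_le_ofReal hMt

theorem isBounded_of_enorm_laplace_lt (hμ : HasCompactSupp μ) (hμ₀ : μ univ = 0)
    (hreal : ∀ x : ℝ, 0 < x → (laplace μ x).im = 0)
    (hKne : K.Nonempty) (hKconj : ∀ ξ ∈ K, sectorConj ξ ∈ K) (hμK : ∀ᵐ ξ ∂μ.variation, ξ ∈ K)
    {σ : Set ℂ} {η A t₀ : ℝ} (hη : 0 < η) (hσ : ∀ c ∈ σ, ∀ ξ ∈ K, (ξ * c).re + η * ‖c‖ ≤ A)
    (ht₀ : 0 < t₀)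
    (hlt : ∀ c ∈ σ, ∀ t : ℝ, 0 < t → t ≤ t₀ →
      ‖laplace μ (-t * c)‖ₑ < supOnPos (laplace μ)) : Bornology.IsBounded σ := by
  rcases σ.eq_empty_or_nonempty with rfl | ⟨c₀, hc₀⟩
  · exact Bornology.isBounded_empty
  have hpos : 0 < supOnPos (laplace μ) := pos_of_gt (hlt c₀ hc₀ t₀ ht₀ le_rfl)
  obtain ⟨R, hR, hRmax⟩ := exists_radius_forall_supOnPos_le hμ hμ₀ hreal hpos hKne hKconj hμK
    (half_pos hη)
  refine isBounded_iff_forall_norm_le.2 ⟨max (2 * A / η) (R / t₀), fun c hc => ?_⟩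
  by_contra! hcC
  obtain ⟨hcA, hcR⟩ := max_lt_iff.1 hcC
  have hc₀ : 0 < ‖c‖ := (div_pos hR ht₀).trans hcR
  obtain ⟨t, ht, htR, hsup⟩ := hRmax (-c) (neg_ne_zero.2 (norm_pos_iff.1 hc₀)) fun ξ hξ => by
    rw [div_lt_iff₀ hη] at hcA
    rw [norm_neg, neg_mul, Complex.neg_re, mul_comm c]
    linarith [hσ c hc ξ hξ]
  have htt₀ : t ≤ t₀ := by
    rw [norm_neg] at htR
    rw [div_lt_iff₀' ht₀] at hcR
    exact (lt_of_mul_lt_mul_right (htR.trans hcR) hc₀.le).le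
  refine (hlt c hc t ht htt₀).not_ge ?_
  rwa [neg_mul_comm]

end LaplaceGrowth

section Idempotents

variable {U : Type*} [NormedCommRing U] [NormedAlgebra ℂ U] [CompleteSpace U]

theorem mem_spectrum_iff_exists_algHom {x : U} {z : ℂ} :
    z ∈ spectrum ℂ x ↔ ∃ χ : U →ₐ[ℂ] ℂ, χ x = z := by
  rw [WeakDual.CharacterSpace.mem_spectrum_iff_exists]
  refine ⟨fun ⟨χ, hχ⟩ => ⟨WeakDual.CharacterSpace.equivAlgHom χ, ?_⟩,
    fun ⟨χ, hχ⟩ => ⟨WeakDual.CharacterSpace.equivAlgHom.symm χ, ?_⟩⟩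
  · rwa [WeakDual.CharacterSpace.equivAlgHom_coe]
  · rwa [WeakDual.CharacterSpace.equivAlgHom_symm_coe]

theorem isUnit_of_forall_algHom_ne_zero {x : U} (h : ∀ χ : U →ₐ[ℂ] ℂ, χ x ≠ 0) : IsUnit x := by
  rw [← spectrum.zero_notMem_iff ℂ, mem_spectrum_iff_exists_algHom]
  exact fun ⟨χ, hχ⟩ => h χ hχ

theorem spectralRadius_le_of_forall_algHom {y : U} {r : ℝ}
    (h : ∀ χ : U →ₐ[ℂ] ℂ, ‖χ y‖ ≤ r) : spectralRadius ℂ y ≤ ENNReal.ofReal r := by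
  refine iSup₂_le fun z hz => ?_
  obtain ⟨χ, rfl⟩ := mem_spectrum_iff_exists_algHom.1 hz
  rw [← enorm_eq_nnnorm, ← ofReal_norm]
  exact ENNReal.ofReal_le_ofReal (h χ)

theorem eventually_norm_pow_le {R : Type*} [NormedRing R] [NormedAlgebra ℂ R] [CompleteSpace R]
    {y : R} {r : ℝ} (h : spectralRadius ℂ y < ENNReal.ofReal r) :
    ∀ᶠ n : ℕ in atTop, ‖y ^ n‖ ≤ r ^ n := by
  have hlim := spectrum.pow_norm_pow_one_div_tendsto_nhds_spectralRadius y
  filter_upwards [hlim.eventually_lt_const h, eventually_gt_atTop 0] with n hn hn₀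
  have hroot : ‖y ^ n‖ ^ (1 / n : ℝ) < r :=
    (ENNReal.ofReal_lt_ofReal_iff_of_nonneg (by positivity)).1 hn
  calc ‖y ^ n‖ = (‖y ^ n‖ ^ (1 / n : ℝ)) ^ n := by
        rw [one_div, Real.rpow_inv_natCast_pow (norm_nonneg _) hn₀.ne']
    _ ≤ r ^ n := by gcongr

theorem summable_norm_smul_pow {R : Type*} [NormedRing R] [NormedAlgebra ℂ R] [CompleteSpace R]
    {y : R} {r s : ℝ} (hy : spectralRadius ℂ y < ENNReal.ofReal r) (hs : 0 ≤ s) (hsr : s * r < 1)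
    {b : ℕ → ℂ} (hb : ∀ n, ‖b n‖ ≤ s ^ n) : Summable fun n => ‖b n • y ^ n‖ := by
  have hr : 0 ≤ r := (ENNReal.ofReal_pos.1 (hy.trans_le' bot_le)).le
  refine Summable.of_norm_bounded_eventually_nat (g := fun n => (s * r) ^ n)
    (summable_geometric_of_lt_one (by positivity) hsr) ?_
  filter_upwards [eventually_norm_pow_le hy] with n hn
  rw [norm_norm, norm_smul, mul_pow]
  exact mul_le_mul (hb n) hn (norm_nonneg _) (by positivity)

theorem catalan_le_four_pow (n : ℕ) : catalan n ≤ 4 ^ n := by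
  rw [catalan_eq_centralBinom_div]
  exact (Nat.div_le_self _ _).trans (Nat.centralBinom_le_four_pow n)

-- `c = ∑ Cₙ yⁿ` is the generating function of the Catalan numbers.
theorem exists_eq_one_add_mul_sq {y : U} (hy : ∀ χ : U →ₐ[ℂ] ℂ, ‖χ y‖ ≤ 1 / 8) :
    ∃ c : U, c = 1 + y * c ^ 2 ∧ ∀ χ : U →ₐ[ℂ] ℂ, ‖χ c‖ ≤ 2 := by
  have hρ : spectralRadius ℂ y < ENNReal.ofReal (1 / 6) :=
    (spectralRadius_le_of_forall_algHom hy).trans_lt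
      ((ENNReal.ofReal_lt_ofReal_iff (by norm_num)).2 (by norm_num))
  have hC : ∀ n : ℕ, ‖(catalan n : ℂ)‖ ≤ 4 ^ n := fun n => by
    rw [Complex.norm_natCast]
    exact_mod_cast catalan_le_four_pow n
  have hs : Summable fun n : ℕ => ‖(catalan n : ℂ) • y ^ n‖ :=
    summable_norm_smul_pow hρ (by norm_num) (by norm_num) hC
  have hsq : HasSum (fun n : ℕ => (catalan (n + 1) : ℂ) • y ^ n)
      ((∑' n : ℕ, (catalan n : ℂ) • y ^ n) ^ 2) := by
    have hprod := summable_norm_sum_mul_antidiagonal_of_summable_norm hs hs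
    rw [sq, tsum_mul_tsum_eq_tsum_sum_antidiagonal_of_summable_norm hs hs]
    convert! hprod.of_norm.hasSum using 2 with n
    rw [catalan_succ', Nat.cast_sum, Finset.sum_smul]
    refine Finset.sum_congr rfl fun ij hij => ?_
    rw [smul_mul_smul_comm, ← pow_add, Finset.HasAntidiagonal.mem_antidiagonal.1 hij, Nat.cast_mul]
  refine ⟨∑' n : ℕ, (catalan n : ℂ) • y ^ n, ?_, fun χ => ?_⟩
  · conv_lhs => rw [hs.of_norm.tsum_eq_zero_add]
    rw [← (hsq.mul_left y).tsum_eq]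
    simp only [catalan_zero, Nat.cast_one, pow_zero, one_smul, mul_smul_comm, pow_succ']
  · have hgeom : HasSum (fun n : ℕ => (1 / 2 : ℝ) ^ n) 2 := hasSum_geometric_two
    rw [hs.of_norm.map_tsum χ (map_continuous χ)]
    refine tsum_of_norm_bounded hgeom fun n => ?_
    rw [map_smul, map_pow, norm_smul, norm_pow]
    calc ‖(catalan n : ℂ)‖ * ‖χ y‖ ^ n ≤ 4 ^ n * (1 / 8) ^ n := by
          gcongr
          exacts [hC n, hy χ]
      _ = (1 / 2) ^ n := by rw [← mul_pow]; norm_num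

-- With `y = a (1 - a)` and `z` the small root of `z (1 - z) = y`, one has
-- `(1 - 2 a) ^ 2 = (1 - 2 z) ^ 2`, and `(a - z) / (1 - 2 z)` is an idempotent.
theorem exists_isIdempotentElem_mul {a : U} (h : ∀ χ : U →ₐ[ℂ] ℂ, ‖χ (a * (1 - a))‖ ≤ 1 / 8) :
    ∃ q : U, IsIdempotentElem (a * q) ∧ ∀ χ : U →ₐ[ℂ] ℂ, ‖χ (a * q) - χ a‖ ≤ 1 / 4 := by
  obtain ⟨c, hc, hχc⟩ := exists_eq_one_add_mul_sq h
  set z := a * (1 - a) * c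
  have hz : z * (1 - z) = a * (1 - a) := by linear_combination a * (1 - a) * hc
  have hχz : ∀ χ : U →ₐ[ℂ] ℂ, ‖χ z‖ ≤ 1 / 4 := fun χ => by
    rw [map_mul, norm_mul]
    calc ‖χ (a * (1 - a))‖ * ‖χ c‖ ≤ 1 / 8 * 2 := by
          gcongr
          exacts [h χ, hχc χ]
      _ = 1 / 4 := by norm_num
  have hunit : IsUnit (1 - 2 * z) := isUnit_of_forall_algHom_ne_zero fun χ h₀ => by
    have hhalf : χ z = 1 / 2 := by
      rw [map_sub, map_mul, map_one, map_ofNat] at h₀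
      linear_combination -h₀ / 2
    have := hχz χ
    rw [hhalf] at this
    norm_num at this
  obtain ⟨w, hw⟩ := hunit.exists_right_inv
  have hp : a * ((1 - (1 - a) * c) * w) = (a - z) * w := by ring
  have hidem : IsIdempotentElem ((a - z) * w) := by
    change (a - z) * w * ((a - z) * w) = (a - z) * w
    linear_combination (a - z) * w * hw + w ^ 2 * hz
  have hsq : ((a - z) * w - a) ^ 2 = z ^ 2 := by
    have hsqrt : (a - z) * w - a = -z * (1 - 2 * a) * w := by linear_combination a * hw
    have hdisc : (1 - 2 * a) ^ 2 = (1 - 2 * z) ^ 2 := by linear_combination 4 * hz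
    calc ((a - z) * w - a) ^ 2 = z ^ 2 * ((1 - 2 * z) * w) ^ 2 := by
          rw [hsqrt, mul_pow, mul_pow, neg_sq, hdisc]; ring
      _ = z ^ 2 := by rw [hw, one_pow, mul_one]
  refine ⟨(1 - (1 - a) * c) * w, by rwa [hp], fun χ => ?_⟩
  have hχ : ‖χ ((a - z) * w) - χ a‖ ^ 2 = ‖χ z‖ ^ 2 := by
    rw [← map_sub, ← norm_pow, ← map_pow, hsq, map_pow, norm_pow]
  rw [hp, (pow_left_inj₀ (norm_nonneg _) (norm_nonneg _) two_ne_zero).1 hχ]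
  exact hχz χ

end Idempotents

section Unitization

variable {A : Type*} [NonUnitalNormedRing A] [NormedSpace ℂ A] [IsScalarTower ℂ A A]
  [SMulCommClass ℂ A A]

/-- The unitization of a complex Banach algebra, normed by `‖(c, a)‖ = |c| + ‖a‖`; with this norm it
is again a Banach algebra. -/
abbrev L1Unitization (A : Type*) := WithLp 1 (Unitization ℂ A)

noncomputable instance {A : Type*} [NonUnitalNormedCommRing A] [NormedSpace ℂ A]
    [IsScalarTower ℂ A A] [SMulCommClass ℂ A A] : NormedCommRing (L1Unitization A) :=
  { WithLp.instUnitizationNormedRing with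
    mul_comm := fun _ _ => WithLp.ofLp_injective 1 (mul_comm _ _) }

/-- The inclusion of a Banach algebra in its unitization. -/
noncomputable def toL1Unitization : A →ₙₐ[ℂ] L1Unitization A :=
  ((WithLp.unitizationAlgEquiv (𝕜 := ℂ) (A := A) ℂ).symm :
    Unitization ℂ A →ₐ[ℂ] L1Unitization A).toNonUnitalAlgHom.comp
    (Unitization.inrNonUnitalAlgHom ℂ A)

theorem isometry_toL1Unitization : Isometry (toL1Unitization (A := A)) :=
  WithLp.unitization_isometry_inr

theorem specRadius_eq_spectralRadius (a : A) :
    specRadius a = spectralRadius ℂ (toL1Unitization a) := by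
  have hspec : spectrum ℂ (toL1Unitization a) = quasispectrum ℂ a :=
    (AlgEquiv.spectrum_eq (WithLp.unitizationAlgEquiv (𝕜 := ℂ) (A := A) ℂ).symm
      (a : Unitization ℂ A)).trans (Unitization.quasispectrum_eq_spectrum_inr ℂ a).symm
  rw [specRadius, spectralRadius, hspec]
  rfl

instance : NormOneClass (L1Unitization A) where
  norm_one := by
    rw [WithLp.unitization_norm_def]
    change ‖(1 : ℂ)‖ + ‖(0 : A)‖ = 1
    rw [norm_one, norm_zero, add_zero]

theorem specRadius_le_enorm [CompleteSpace A] (a : A) : specRadius a ≤ ‖a‖ₑ := by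
  calc specRadius a = spectralRadius ℂ (toL1Unitization a) := specRadius_eq_spectralRadius a
    _ ≤ ‖toL1Unitization a‖₊ := spectrum.spectralRadius_le_nnnorm _
    _ = ‖a‖ₑ := congrArg _ (WithLp.unitization_nnnorm_inr a)

theorem exists_toL1Unitization_eq_mul (a : A) (x : L1Unitization A) :
    ∃ b : A, toL1Unitization b = toL1Unitization a * x := by
  refine ⟨(WithLp.ofLp x).fst • a + a * (WithLp.ofLp x).snd, WithLp.ofLp_injective 1 ?_⟩
  change ((_ : A) : Unitization ℂ A) = (a : Unitization ℂ A) * WithLp.ofLp x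
  ext <;> simp

end Unitization

section IsometricHom

theorem spectralRadius_map_of_norm_eq {R S : Type*} [NormedRing R] [NormedAlgebra ℂ R]
    [CompleteSpace R] [NormedRing S] [NormedAlgebra ℂ S] [CompleteSpace S] (φ : R →ₐ[ℂ] S)
    (hφ : ∀ x, ‖φ x‖ = ‖x‖) (x : R) : spectralRadius ℂ (φ x) = spectralRadius ℂ x := by
  refine tendsto_nhds_unique (spectrum.pow_norm_pow_one_div_tendsto_nhds_spectralRadius _) ?_
  simpa only [← map_pow, hφ] using spectrum.pow_norm_pow_one_div_tendsto_nhds_spectralRadius x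

theorem specRadius_map_of_norm_eq {A B : Type*} [NonUnitalNormedRing A] [NormedSpace ℂ A]
    [IsScalarTower ℂ A A] [SMulCommClass ℂ A A] [CompleteSpace A] [NonUnitalNormedRing B]
    [NormedSpace ℂ B] [IsScalarTower ℂ B B] [SMulCommClass ℂ B B] [CompleteSpace B]
    (j : A →ₙₐ[ℂ] B) (hj : ∀ a, ‖j a‖ = ‖a‖) (a : A) : specRadius (j a) = specRadius a := by
  let J : L1Unitization A →ₐ[ℂ] L1Unitization B :=
    (Unitization.lift (toL1Unitization.comp j)).comp
      (WithLp.unitizationAlgEquiv (𝕜 := ℂ) (A := A) ℂ : L1Unitization A →ₐ[ℂ] Unitization ℂ A)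
  have hJ : ∀ x, WithLp.ofLp (J x) =
      Unitization.inl (WithLp.ofLp x).fst + ((j (WithLp.ofLp x).snd : B) : Unitization ℂ B) :=
    fun _ => rfl
  have hJnorm : ∀ x, ‖J x‖ = ‖x‖ := fun x => by
    rw [WithLp.unitization_norm_def, WithLp.unitization_norm_def, hJ]
    simp [hj]
  have hJa : J (toL1Unitization a) = toL1Unitization (j a) :=
    DFunLike.congr_fun (Unitization.lift.symm_apply_apply (toL1Unitization.comp j)) a
  rw [specRadius_eq_spectralRadius, specRadius_eq_spectralRadius, ← hJa,
    spectralRadius_map_of_norm_eq J hJnorm]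

end IsometricHom

section MultiplicativeFunctionals

variable {A : Type*} [NonUnitalNormedRing A] [NormedSpace ℂ A] [IsScalarTower ℂ A A]
  [SMulCommClass ℂ A A]

theorem exists_algHom_comp_toL1Unitization (f : A →ₙₐ[ℂ] ℂ) :
    ∃ χ : L1Unitization A →ₐ[ℂ] ℂ, ∀ a, χ (toL1Unitization a) = f a :=
  ⟨(Unitization.lift f).comp
    (WithLp.unitizationAlgEquiv (𝕜 := ℂ) (A := A) ℂ : L1Unitization A →ₐ[ℂ] Unitization ℂ A),
    DFunLike.congr_fun (Unitization.lift.symm_apply_apply f)⟩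

theorem apply_mem_quasispectrum (f : A →ₙₐ[ℂ] ℂ) (a : A) : f a ∈ quasispectrum ℂ a := by
  rw [Unitization.quasispectrum_eq_spectrum_inr,
    ← DFunLike.congr_fun (Unitization.lift.symm_apply_apply f) a]
  exact AlgHom.apply_mem_spectrum (Unitization.lift f) (a : Unitization ℂ A)

theorem enorm_apply_le_specRadius (f : A →ₙₐ[ℂ] ℂ) (a : A) : ‖f a‖ₑ ≤ specRadius a :=
  le_iSup₂ (f := fun z (_ : z ∈ quasispectrum ℂ a) => ‖z‖ₑ) _ (apply_mem_quasispectrum f a)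

theorem norm_apply_le [CompleteSpace A] (f : A →ₙₐ[ℂ] ℂ) (a : A) : ‖f a‖ ≤ ‖a‖ :=
  enorm_le_iff_norm_le.1 ((enorm_apply_le_specRadius f a).trans (specRadius_le_enorm a))

theorem continuous_hom [CompleteSpace A] (f : A →ₙₐ[ℂ] ℂ) : Continuous f :=
  AddMonoidHomClass.continuous_of_bound f 1 fun a => (norm_apply_le f a).trans_eq (one_mul _).symm

end MultiplicativeFunctionals

section GelfandTheory

variable {A : Type*} [NonUnitalNormedCommRing A] [NormedSpace ℂ A] [IsScalarTower ℂ A A]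
  [SMulCommClass ℂ A A] [CompleteSpace A]

theorem mem_radical_iff_forall_hom {a : A} : a ∈ radical A ↔ ∀ f : A →ₙₐ[ℂ] ℂ, f a = 0 := by
  rw [mem_radical_iff]
  refine ⟨fun ha f => ?_, fun ha => ?_⟩
  · simpa [ha] using enorm_apply_le_specRadius f a
  · rw [specRadius_eq_spectralRadius, ← nonpos_iff_eq_zero, ← ENNReal.ofReal_zero]
    refine spectralRadius_le_of_forall_algHom fun χ => ?_
    exact (norm_eq_zero.2 (ha (χ.toNonUnitalAlgHom.comp toL1Unitization))).le

theorem exists_isIdempotentElem_norm_sub_le {a : A}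
    (h : ∀ f : A →ₙₐ[ℂ] ℂ, ‖f a * (1 - f a)‖ ≤ 1 / 8) :
    ∃ p : A, IsIdempotentElem p ∧ ∀ f : A →ₙₐ[ℂ] ℂ, ‖f p - f a‖ ≤ 1 / 4 := by
  obtain ⟨q, hq, hqa⟩ := exists_isIdempotentElem_mul (a := toL1Unitization a) fun χ => by
    rw [map_mul, map_sub, map_one]
    exact h (χ.toNonUnitalAlgHom.comp toL1Unitization)
  obtain ⟨p, hp⟩ := exists_toL1Unitization_eq_mul a q
  rw [← hp] at hq hqa
  refine ⟨p, isometry_toL1Unitization.injective ((map_mul _ _ _).trans hq), fun f => ?_⟩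
  obtain ⟨χ, hχ⟩ := exists_algHom_comp_toL1Unitization f
  rw [← hχ, ← hχ]
  exact hqa χ

theorem exists_isIdempotentElem_of_near_zero_or_one {a : A}
    (h : ∀ f : A →ₙₐ[ℂ] ℂ, f a = 0 ∨ ‖f a - 1‖ ≤ 1 / 10) :
    ∃ p : A, IsIdempotentElem p ∧
      ∀ f : A →ₙₐ[ℂ] ℂ, (f a = 0 → f p = 0) ∧ (‖f a - 1‖ ≤ 1 / 10 → f p = 1) := by
  obtain ⟨p, hp, hpa⟩ := exists_isIdempotentElem_norm_sub_le (a := a) fun f => by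
    rcases h f with h₀ | h₁
    · simp [h₀]
    · have hfa : ‖f a‖ ≤ 1 + 1 / 10 := by
        calc ‖f a‖ ≤ ‖(1 : ℂ)‖ + ‖f a - 1‖ := norm_le_norm_add_norm_sub' _ _
          _ ≤ 1 + 1 / 10 := by rw [norm_one]; gcongr
      rw [norm_mul, norm_sub_rev]
      calc ‖f a‖ * ‖f a - 1‖ ≤ (1 + 1 / 10) * (1 / 10) := by gcongr
        _ ≤ 1 / 8 := by norm_num
  refine ⟨p, hp, fun f => ?_⟩
  have hfp : f p = 0 ∨ f p = 1 := IsIdempotentElem.iff_eq_zero_or_one.1 (hp.map f)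
  have hfpa := hpa f
  refine ⟨fun h₀ => hfp.resolve_right fun h₁ => ?_, fun h₁ => hfp.resolve_left fun h₀ => ?_⟩
  · rw [h₁, h₀, sub_zero, norm_one] at hfpa
    norm_num at hfpa
  · rw [h₀, zero_sub, norm_neg] at hfpa
    have htri := norm_sub_norm_le 1 (f a)
    rw [norm_one, norm_sub_rev] at htri
    linarith

end GelfandTheory

section Semigroups

variable {α : ℝ} {B : Type*} [NonUnitalNormedRing B] [NormedSpace ℂ B] {T : ℂ → B}

theorem IsAnalyticSemigroup.map {F : Type*} [NonUnitalNormedRing F] [NormedSpace ℂ F]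
    (hT : IsAnalyticSemigroup α T) (j : B →ₙₐ[ℂ] F) (hj : Continuous j) :
    IsAnalyticSemigroup α fun t => j (T t) where
  differentiableOn :=
    ContinuousLinearMap.differentiable ⟨(j : B →ₗ[ℂ] F), hj⟩ |>.comp_differentiableOn
      hT.differentiableOn
  map_add s hs t ht := by rw [hT.map_add s hs t ht, map_mul]

theorem IsAnalyticSemigroup.hasDerivAt (hT : IsAnalyticSemigroup α T) {t : ℂ}
    (ht : t ∈ sector α) : HasDerivAt T (deriv T t) t :=
  (hT.differentiableOn.differentiableAt (isOpen_sector.mem_nhds ht)).hasDerivAt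

theorem IsAnalyticSemigroup.continuous_ofReal_mul (hT : IsAnalyticSemigroup α T) {t : ℝ}
    (ht : 0 < t) : Continuous fun ξ : sector α => T (t * ξ) :=
  hT.differentiableOn.continuousOn.comp_continuous (by fun_prop)
    fun ξ => ofReal_mul_mem_sector ht ξ.2

theorem IsAnalyticSemigroup.integrable_ofReal_mul [CompleteSpace B] (hT : IsAnalyticSemigroup α T)
    {μ : ComplexMeasure (sector α)} (hμ : HasCompactSupp μ) {t : ℝ} (ht : 0 < t) :
    Integrable (fun ξ : sector α => T (t * ξ)) μ.variation := by
  obtain ⟨K, hK, hμK⟩ := hμ.exists_isCompact_ae_mem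
  exact integrable_of_ae_mem_isCompact hK hμK (hT.continuous_ofReal_mul ht)

theorem IsAnalyticSemigroup.map_funcCalc [CompleteSpace B] {F : Type*} [NonUnitalNormedRing F]
    [NormedSpace ℂ F] [CompleteSpace F] (hT : IsAnalyticSemigroup α T)
    {μ : ComplexMeasure (sector α)} (hμ : HasCompactSupp μ) (j : B →ₙₐ[ℂ] F) (hj : Continuous j)
    {t : ℝ} (ht : 0 < t) :
    j (funcCalc μ T t) = funcCalc μ (fun s => j (T s)) t :=
  map_cintegral ⟨(j : B →ₗ[ℂ] F), hj⟩ (hT.integrable_ofReal_mul hμ ht)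

theorem IsAnalyticSemigroup.deriv_mul_eq_mul_deriv {R : Type*} [NormedRing R]
    [NormedAlgebra ℂ R] {T : ℂ → R} (hT : IsAnalyticSemigroup α T) {s t : ℂ} (hs : s ∈ sector α)
    (ht : t ∈ sector α) : deriv T s * T t = T s * deriv T t := by
  have hst := hT.hasDerivAt (add_mem_sector hs ht)
  have hleft : HasDerivAt (fun w => T (w + t)) (deriv T s * T t) s := by
    refine ((hT.hasDerivAt hs).mul_const (T t)).congr_of_eventuallyEq ?_
    filter_upwards [isOpen_sector.mem_nhds hs] with w hw using hT.map_add w hw t ht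
  have hright : HasDerivAt (fun w => T (s + w)) (T s * deriv T t) t := by
    refine ((hT.hasDerivAt ht).const_mul (T s)).congr_of_eventuallyEq ?_
    filter_upwards [isOpen_sector.mem_nhds ht] with w hw using hT.map_add s hs w hw
  exact (hleft.unique (hst.comp_add_const s t)).trans
    ((hst.comp_const_add s t).unique hright)

theorem IsAnalyticSemigroup.eq_zero_of_apply_eq_zero [CompleteSpace B]
    (hT : IsAnalyticSemigroup α T) {t₁ : ℂ} (ht₁ : t₁ ∈ sector α) (h₀ : T t₁ = 0) :
    ∀ t ∈ sector α, T t = 0 := by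
  refine (hT.differentiableOn.analyticOnNhd
    isOpen_sector).eqOn_zero_of_preconnected_of_eventuallyEq_zero convex_sector.isPreconnected
    (add_mem_sector ht₁ ht₁) ?_
  have hsub : Tendsto (fun s => s - t₁) (𝓝 (t₁ + t₁)) (𝓝 t₁) :=
    (continuous_sub_right t₁).tendsto' _ _ (add_sub_cancel_right t₁ t₁)
  filter_upwards [hsub.eventually (isOpen_sector.mem_nhds ht₁)] with s hs
  have hs' := hT.map_add t₁ ht₁ _ hs
  rwa [add_sub_cancel, h₀, zero_mul] at hs'

theorem IsAnalyticSemigroup.mul_add_one_sub {R : Type*} [NormedCommRing R] [NormedAlgebra ℂ R]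
    {T : ℂ → R} (hT : IsAnalyticSemigroup α T) {p : R} (hp : IsIdempotentElem p) :
    IsAnalyticSemigroup α fun t => T t * p + (1 - p) where
  differentiableOn := (hT.differentiableOn.mul_const p).add_const _
  map_add s hs t ht := by
    rw [hT.map_add s hs t ht]
    linear_combination (T s + T t - T s * T t - 1) * hp.eq

end Semigroups

section Exponentials

variable {α : ℝ} {U : Type*} [NormedCommRing U] [NormedAlgebra ℂ U] [CompleteSpace U] {V : ℂ → U}

theorem exp_smul_mul_exp_smul_neg (t : ℂ) (u : U) :
    NormedSpace.exp (t • u) * NormedSpace.exp (t • -u) = 1 := by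
  let : NormedAlgebra ℚ U := NormedAlgebra.restrictScalars ℚ ℂ U
  rw [← NormedSpace.exp_add, smul_neg, add_neg_cancel, NormedSpace.exp_zero]

theorem exists_eq_exp_smul_mul {S : Set ℂ} (hS : IsOpen S) (hSc : IsPreconnected S) {u : U}
    (hV : ∀ t ∈ S, HasDerivAt V (u * V t) t) :
    ∃ k : U, ∀ t ∈ S, V t = NormedSpace.exp (t • u) * k := by
  have hconst : ∀ t ∈ S, HasDerivAt (fun s => NormedSpace.exp (s • -u) * V s) 0 t := fun t ht =>
    ((hasDerivAt_exp_smul_const (-u) t).mul (hV t ht)).congr_deriv (by ring)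
  obtain ⟨k, hk⟩ := hS.exists_is_const_of_deriv_eq_zero hSc
    (fun t ht => (hconst t ht).differentiableAt.differentiableWithinAt)
    fun t ht => (hconst t ht).deriv
  refine ⟨k, fun t ht => ?_⟩
  rw [← hk t ht, ← mul_assoc, exp_smul_mul_exp_smul_neg, one_mul]

theorem IsAnalyticSemigroup.exists_eq_exp (hV : IsAnalyticSemigroup α V) (hα₀ : 0 < α)
    (hunit : ∀ t ∈ sector α, IsUnit (V t)) :
    ∃ u : U, ∀ t ∈ sector α, V t = NormedSpace.exp (t • u) := by
  have h₁ : (1 : ℂ) ∈ sector α := by simpa using ofReal_mem_sector hα₀ one_pos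
  obtain ⟨v, hv⟩ := (hunit 1 h₁).exists_right_inv
  have hderiv : ∀ t ∈ sector α, HasDerivAt V (deriv V 1 * v * V t) t := fun t ht =>
    (hV.hasDerivAt ht).congr_deriv <| by
      linear_combination v * hV.deriv_mul_eq_mul_deriv ht h₁ - deriv V t * hv
  obtain ⟨k, hk⟩ := exists_eq_exp_smul_mul isOpen_sector convex_sector.isPreconnected hderiv
  have hkk : V (1 + 1) * k = V (1 + 1) * 1 := by
    let : NormedAlgebra ℚ U := NormedAlgebra.restrictScalars ℚ ℂ U
    have hadd := hV.map_add 1 h₁ 1 h₁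
    have h₂ := hk _ (add_mem_sector h₁ h₁)
    rw [add_smul, NormedSpace.exp_add] at h₂
    rw [mul_one]
    nth_rewrite 2 [hadd]
    rw [h₂, hk 1 h₁]
    ring
  have hk₁ : k = 1 := (hunit _ (add_mem_sector h₁ h₁)).mul_left_cancel hkk
  exact ⟨_, fun t ht => by rw [hk t ht, hk₁, mul_one]⟩

theorem IsAnalyticSemigroup.eq_zero_or_eq_exp {h : ℂ → ℂ} (hh : IsAnalyticSemigroup α h)
    (hα₀ : 0 < α) :
    (∀ t ∈ sector α, h t = 0) ∨ ∃ c : ℂ, ∀ t ∈ sector α, h t = Complex.exp (t * c) := by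
  by_cases hz : ∃ t₁ ∈ sector α, h t₁ = 0
  · obtain ⟨t₁, ht₁, h₀⟩ := hz
    exact Or.inl (hh.eq_zero_of_apply_eq_zero ht₁ h₀)
  · push Not at hz
    obtain ⟨c, hc⟩ := hh.exists_eq_exp hα₀ fun t ht => (hz t ht).isUnit
    exact Or.inr ⟨c, fun t ht => by rw [hc t ht, Complex.exp_eq_exp_ℂ, smul_eq_mul]⟩

end Exponentials

section BoundedGenerator

variable {α : ℝ} {A : Type*} [NonUnitalNormedCommRing A] [NormedSpace ℂ A] [IsScalarTower ℂ A A]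
  [SMulCommClass ℂ A A] [CompleteSpace A] {T : ℂ → A}

/-- The exponents `c` of the functions `t ↦ exp (t c)` into which the multiplicative functionals
transform the semigroup: the spectrum of its generator. -/
def exponentSet (α : ℝ) (T : ℂ → A) : Set ℂ :=
  {c | ∃ f : A →ₙₐ[ℂ] ℂ, ∀ t ∈ sector α, f (T t) = Complex.exp (t * c)}

theorem IsAnalyticSemigroup.hom_eq_zero_or_exists_exponent (hT : IsAnalyticSemigroup α T)
    (hα₀ : 0 < α) (f : A →ₙₐ[ℂ] ℂ) :
    (∀ t ∈ sector α, f (T t) = 0) ∨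
      ∃ c ∈ exponentSet α T, ∀ t ∈ sector α, f (T t) = Complex.exp (t * c) :=
  ((hT.map f (continuous_hom f)).eq_zero_or_eq_exp hα₀).imp_right
    fun ⟨c, hc⟩ => ⟨c, ⟨f, hc⟩, hc⟩

theorem IsAnalyticSemigroup.exists_unitization_eq_exp (hT : IsAnalyticSemigroup α T) (hα₀ : 0 < α)
    {p : A} (hp : IsIdempotentElem p)
    (hpT : ∀ f : A →ₙₐ[ℂ] ℂ, f p = 1 → ∀ t ∈ sector α, f (T t) ≠ 0) :
    ∃ v : L1Unitization A, ∀ t ∈ sector α,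
      toL1Unitization (T t) * toL1Unitization p + (1 - toL1Unitization p) =
        NormedSpace.exp (t • v) := by
  have hV := (hT.map toL1Unitization isometry_toL1Unitization.continuous).mul_add_one_sub
    (hp.map toL1Unitization)
  refine hV.exists_eq_exp hα₀ fun t ht => isUnit_of_forall_algHom_ne_zero fun χ => ?_
  set f := χ.toNonUnitalAlgHom.comp toL1Unitization
  have hχ : χ (toL1Unitization (T t) * toL1Unitization p + (1 - toL1Unitization p)) =
      f (T t) * f p + (1 - f p) := by
    rw [_root_.map_add, map_sub, map_one, map_mul]
    rfl
  rw [hχ]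
  rcases IsIdempotentElem.iff_eq_zero_or_one.1 (hp.map f) with h₀ | h₁
  · simp [h₀]
  · simpa [h₁] using hpT f h₁ t ht

omit [CompleteSpace A] in
theorem toL1Unitization_powWith {p u : A} {v : L1Unitization A} (hp : IsIdempotentElem p)
    (hu : toL1Unitization u = toL1Unitization p * v) (k : ℕ) :
    toL1Unitization (powWith p u k) = toL1Unitization p * v ^ k := by
  induction k with
  | zero => rw [powWith, pow_zero, mul_one]
  | succ k ih =>
    rw [powWith, map_mul, ih, hu]
    linear_combination v ^ k * v * (hp.map toL1Unitization).eq

theorem IsAnalyticSemigroup.exists_hasSum_powWith (hT : IsAnalyticSemigroup α T) (hα₀ : 0 < α)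
    {p : A} (hp : IsIdempotentElem p)
    (hpT : ∀ f : A →ₙₐ[ℂ] ℂ, f p = 1 → ∀ t ∈ sector α, f (T t) ≠ 0) :
    ∃ u : A, ∀ t ∈ sector α,
      HasSum (fun k : ℕ => (t ^ k / (k.factorial : ℂ)) • powWith p u k) (p * T t) := by
  obtain ⟨v, hv⟩ := hT.exists_unitization_eq_exp hα₀ hp hpT
  obtain ⟨u, hu⟩ := exists_toL1Unitization_eq_mul p v
  refine ⟨u, fun t ht => ?_⟩
  have hexp : toL1Unitization p * NormedSpace.exp (t • v) = toL1Unitization (p * T t) := by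
    rw [← hv t ht, map_mul]
    linear_combination (toL1Unitization (T t) - 1) * (hp.map toL1Unitization).eq
  refine (isometry_toL1Unitization.isUniformInducing.isInducing.hasSum_iff _ _).1 ?_
  rw [← hexp]
  convert! (NormedSpace.exp_series_hasSum_exp' (𝕂 := ℂ) (t • v)).mul_left (toL1Unitization p)
    using 2 with k
  rw [Function.comp_apply, map_smul, toL1Unitization_powWith hp hu, smul_pow, smul_smul,
    mul_smul_comm, inv_mul_eq_div]

theorem IsAnalyticSemigroup.exists_idempotent_of_isBounded (hT : IsAnalyticSemigroup α T)
    (hα₀ : 0 < α) (hσ : Bornology.IsBounded (exponentSet α T)) :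
    ∃ p : A, IsIdempotentElem p ∧ ∀ f : A →ₙₐ[ℂ] ℂ,
      (f p = 0 ∧ ∀ t ∈ sector α, f (T t) = 0) ∨ (f p = 1 ∧ ∀ t ∈ sector α, f (T t) ≠ 0) := by
  obtain ⟨C, hC₀, hC⟩ := hσ.exists_pos_norm_le
  set r : ℝ := 1 / (20 * C)
  have hr : 0 < r := by positivity
  have hrσ := ofReal_mem_sector hα₀ hr
  have hnear : ∀ c ∈ exponentSet α T, ‖Complex.exp (r * c) - 1‖ ≤ 1 / 10 := fun c hc => by
    have hrc : ‖(r : ℂ) * c‖ ≤ 1 / 20 := by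
      rw [norm_mul, Complex.norm_real, Real.norm_of_nonneg hr.le]
      calc r * ‖c‖ ≤ r * C := by gcongr; exact hC c hc
        _ = 1 / 20 := by simp only [r]; field_simp
    calc ‖Complex.exp (r * c) - 1‖ ≤ 2 * ‖(r : ℂ) * c‖ :=
          Complex.norm_exp_sub_one_le (hrc.trans (by norm_num))
      _ ≤ 1 / 10 := by linarith
  have hdich : ∀ f : A →ₙₐ[ℂ] ℂ, (f (T r) = 0 ∧ ∀ t ∈ sector α, f (T t) = 0) ∨
      (‖f (T r) - 1‖ ≤ 1 / 10 ∧ ∀ t ∈ sector α, f (T t) ≠ 0) := fun f => by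
    rcases hT.hom_eq_zero_or_exists_exponent hα₀ f with h₀ | ⟨c, hc, hfc⟩
    · exact Or.inl ⟨h₀ _ hrσ, h₀⟩
    · exact Or.inr ⟨hfc _ hrσ ▸ hnear c hc, fun t ht => hfc t ht ▸ Complex.exp_ne_zero _⟩
  obtain ⟨p, hp, hpf⟩ := exists_isIdempotentElem_of_near_zero_or_one fun f =>
    (hdich f).imp And.left And.left
  exact ⟨p, hp, fun f => (hdich f).imp (And.imp_left (hpf f).1) (And.imp_left (hpf f).2)⟩

theorem toModRad_powWith {R : Type*} [NonUnitalRing R] [Module ℂ R] [IsScalarTower ℂ R R]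
    [SMulCommClass ℂ R R] (p u : R) (k : ℕ) :
    toModRad R (powWith p u k) = powWith (toModRad R p) (toModRad R u) k := by
  induction k with
  | zero => rfl
  | succ k ih => rw [powWith, powWith, toModRad_mul, ih]

theorem toModRad_eq_iff_forall_hom {a b : A} :
    toModRad A a = toModRad A b ↔ ∀ f : A →ₙₐ[ℂ] ℂ, f a = f b := by
  simp only [toModRad, Submodule.mkQ_apply, Submodule.Quotient.eq, mem_radical_iff_forall_hom,
    map_sub, sub_eq_zero]

theorem isIdentity_toModRad_iff {p : A} :
    IsIdentity (toModRad A p) ↔ ∀ f : A →ₙₐ[ℂ] ℂ, f p = 1 ∨ f = 0 := by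
  refine ⟨fun hp f => or_iff_not_imp_right.2 fun hf => ?_, fun hp x => ?_⟩
  · obtain ⟨a, ha⟩ := DFunLike.ne_iff.1 hf
    have hpa := toModRad_eq_iff_forall_hom.1 ((toModRad_mul A p a).trans (hp (toModRad A a)).1) f
    exact mul_eq_right₀ ha |>.1 ((map_mul f p a).symm.trans hpa)
  · obtain ⟨a, rfl⟩ := (radical A).mkQ_surjective x
    change toModRad A (p * a) = toModRad A a ∧ toModRad A (a * p) = toModRad A a
    simp only [toModRad_eq_iff_forall_hom, map_mul, ← forall_and]
    intro f
    rcases hp f with hf | rfl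
    · simp [hf]
    · simp

omit [CompleteSpace A] in
theorem continuous_toModRad : Continuous (toModRad A) := continuous_quot_mk

theorem IsAnalyticSemigroup.exists_identity_and_generator (hT : IsAnalyticSemigroup α T)
    (hα₀ : 0 < α) (hgen : ∀ f : A →ₙₐ[ℂ] ℂ, (∀ t ∈ sector α, f (T t) = 0) → f = 0)
    (hσ : Bornology.IsBounded (exponentSet α T)) :
    ∃ e : ModRad A, IsIdentity e ∧ ∃ u : ModRad A, ∀ t ∈ sector α,
      HasSum (fun k : ℕ => (t ^ k / (k.factorial : ℂ)) • powWith e u k) (toModRad A (T t)) := by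
  obtain ⟨p, hp, hpf⟩ := hT.exists_idempotent_of_isBounded hα₀ hσ
  have hid : IsIdentity (toModRad A p) := isIdentity_toModRad_iff.2 fun f =>
    (hpf f).symm.imp And.left fun h => hgen f h.2
  obtain ⟨u, hu⟩ := hT.exists_hasSum_powWith hα₀ hp fun f hfp =>
    (hpf f).elim (fun h => absurd (h.1.symm.trans hfp) zero_ne_one) And.right
  refine ⟨toModRad A p, hid, toModRad A u, fun t ht => ?_⟩
  have hsum := (hu t ht).map (toModRad A) continuous_toModRad
  rw [toModRad_mul, (hid _).1] at hsum
  simpa only [Function.comp_def, map_smul, toModRad_powWith] using hsum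

theorem IsAnalyticSemigroup.exists_re_mul_add_le (hT : IsAnalyticSemigroup α T)
    {K : Set (sector α)} (hK : IsCompact K) :
    ∃ η : ℝ, 0 < η ∧ ∃ M : ℝ, ∀ c ∈ exponentSet α T, ∀ ξ ∈ K, (ξ * c).re + η * ‖c‖ ≤ M := by
  have hS : IsCompact (Subtype.val '' K) := hK.image continuous_subtype_val
  obtain ⟨η, hη, hηS⟩ := hS.exists_cthickening_subset_open isOpen_sector
    (Subtype.coe_image_subset _ K)
  obtain ⟨N, hN⟩ := hS.cthickening.exists_bound_of_continuousOn
    (hT.differentiableOn.continuousOn.mono hηS)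
  refine ⟨η, hη, Real.log N, ?_⟩
  rintro c ⟨f, hf⟩ ξ hξ
  obtain ⟨w, hw, hwc⟩ := Complex.exists_norm_eq_mul_self c
  have hmem : (ξ : ℂ) + η * w ∈ Metric.cthickening η (Subtype.val '' K) := by
    refine Metric.mem_cthickening_of_dist_le _ (ξ : ℂ) η _ (mem_image_of_mem _ hξ) ?_
    rw [dist_eq_norm, add_sub_cancel_left, norm_mul, hw, mul_one, Complex.norm_real,
      Real.norm_of_nonneg hη.le]
  have hre : (((ξ : ℂ) + η * w) * c).re = ((ξ : ℂ) * c).re + η * ‖c‖ := by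
    rw [add_mul, mul_assoc, ← hwc, Complex.add_re, Complex.re_ofReal_mul, Complex.ofReal_re]
  have hexp : Real.exp (((ξ : ℂ) * c).re + η * ‖c‖) ≤ N := by
    rw [← hre, ← Complex.norm_exp, ← hf _ (hηS hmem)]
    exact (norm_apply_le f _).trans (hN _ hmem)
  exact (Real.le_log_iff_exp_le ((Real.exp_pos _).trans_le hexp)).2 hexp

theorem IsAnalyticSemigroup.enorm_laplace_le_specRadius (hT : IsAnalyticSemigroup α T)
    {μ : ComplexMeasure (sector α)} (hμ : HasCompactSupp μ) {c : ℂ} (hc : c ∈ exponentSet α T)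
    {t : ℝ} (ht : 0 < t) : ‖laplace μ (-t * c)‖ₑ ≤ specRadius (funcCalc μ T t) := by
  obtain ⟨f, hf⟩ := hc
  have hfT : f (funcCalc μ T t) = laplace μ (-t * c) := by
    rw [hT.map_funcCalc hμ f (continuous_hom f) ht]
    refine congrArg (cintegral μ) (funext fun ξ => ?_)
    refine (hf _ (ofReal_mul_mem_sector ht ξ.2)).trans (congrArg Complex.exp ?_)
    ring
  exact hfT ▸ enorm_apply_le_specRadius f _

theorem IsAnalyticSemigroup.isBounded_exponentSet (hT : IsAnalyticSemigroup α T) (hα₀ : 0 < α)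
    {μ : ComplexMeasure (sector α)} (hμ : HasCompactSupp μ) (hμ₀ : μ univ = 0)
    (hreal : ∀ x : ℝ, 0 < x → (laplace μ x).im = 0) {t₀ : ℝ} (ht₀ : 0 < t₀)
    (hlt : ∀ t : ℝ, 0 < t → t ≤ t₀ → specRadius (funcCalc μ T t) < supOnPos (laplace μ)) :
    Bornology.IsBounded (exponentSet α T) := by
  obtain ⟨K, hK, hKne, hKconj, hμK⟩ := hμ.exists_isCompact_conj_stable hα₀
  obtain ⟨η, hη, M, hM⟩ := hT.exists_re_mul_add_le hK
  exact isBounded_of_enorm_laplace_lt hμ hμ₀ hreal hKne hKconj hμK hη hM ht₀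
    fun c hc t ht htt₀ => (hT.enorm_laplace_le_specRadius hμ hc ht).trans_lt (hlt t ht htt₀)

end BoundedGenerator

section GeneratedAlgebra

variable {B : Type*} [NonUnitalNormedRing B] [NormedSpace ℂ B]

noncomputable instance (S : NonUnitalSubalgebra ℂ B) : NormedSpace ℂ S where
  norm_smul_le c x := norm_smul_le c (x : B)

variable [IsScalarTower ℂ B B] [SMulCommClass ℂ B B] {α : ℝ} {T : ℂ → B}

theorem isClosed_semigroupAlgebra : IsClosed (semigroupAlgebra α T : Set B) :=
  NonUnitalSubalgebra.isClosed_topologicalClosure _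

instance [CompleteSpace B] : CompleteSpace (semigroupAlgebra α T) :=
  isClosed_semigroupAlgebra.completeSpace_coe

theorem IsAnalyticSemigroup.mul_comm_of_mem (hT : IsAnalyticSemigroup α T)
    (x y : semigroupAlgebra α T) : x * y = y * x := by
  have hcomm : IsMulCommutative (NonUnitalAlgebra.adjoin ℂ (T '' sector α)) := by
    refine NonUnitalAlgebra.isMulCommutative_adjoin ℂ ?_
    rintro _ ⟨s, hs, rfl⟩ _ ⟨t, ht, rfl⟩
    rw [← hT.map_add s hs t ht, ← hT.map_add t ht s hs, add_comm]
  exact (NonUnitalSubalgebra.nonUnitalCommRingTopologicalClosure _ hcomm.is_comm.comm).mul_comm x y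

/-- The algebra generated by an analytic semigroup, as a commutative normed ring. -/
abbrev IsAnalyticSemigroup.nonUnitalNormedCommRing (hT : IsAnalyticSemigroup α T) :
    NonUnitalNormedCommRing (semigroupAlgebra α T) where
  mul_comm := hT.mul_comm_of_mem

open Classical in
/-- A semigroup as a map into the algebra it generates, extended by `0` off the sector. -/
noncomputable def restrictSemigroup (α : ℝ) (T : ℂ → B) (t : ℂ) : semigroupAlgebra α T :=
  if ht : t ∈ sector α then ⟨T t, mem_semigroupAlgebra T ht⟩ else 0

theorem restrictSemigroup_of_mem {t : ℂ} (ht : t ∈ sector α) :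
    restrictSemigroup α T t = ⟨T t, mem_semigroupAlgebra T ht⟩ := dif_pos ht

theorem coe_restrictSemigroup {t : ℂ} (ht : t ∈ sector α) :
    (restrictSemigroup α T t : B) = T t := by rw [restrictSemigroup_of_mem ht]

theorem IsAnalyticSemigroup.restrict (hT : IsAnalyticSemigroup α T) :
    IsAnalyticSemigroup α (restrictSemigroup α T) where
  map_add s hs t ht := Subtype.ext <| by
    rw [NonUnitalSubalgebra.coe_mul, coe_restrictSemigroup hs, coe_restrictSemigroup ht,
      coe_restrictSemigroup (add_mem_sector hs ht), hT.map_add s hs t ht]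
  differentiableOn t ht := by
    have hcoe : HasDerivAt (fun s => (restrictSemigroup α T s : B)) (deriv T t) t :=
      (hT.hasDerivAt ht).congr_of_eventuallyEq <| by
        filter_upwards [isOpen_sector.mem_nhds ht] with s hs using coe_restrictSemigroup hs
    have hslope := hasDerivAt_iff_tendsto_slope.1 hcoe
    have hmem : deriv T t ∈ semigroupAlgebra α T :=
      isClosed_semigroupAlgebra.mem_of_tendsto hslope <| Eventually.of_forall fun s =>
        (slope (restrictSemigroup α T) t s).2
    have hderiv : HasDerivAt (restrictSemigroup α T) ⟨deriv T t, hmem⟩ t :=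
      hasDerivAt_iff_tendsto_slope.2 (tendsto_subtype_rng.2 hslope)
    exact hderiv.differentiableAt.differentiableWithinAt

theorem IsAnalyticSemigroup.specRadius_funcCalc_restrictSemigroup [CompleteSpace B]
    (hT : IsAnalyticSemigroup α T) {μ : ComplexMeasure (sector α)} (hμ : HasCompactSupp μ) {t : ℝ}
    (ht : 0 < t) :
    specRadius (funcCalc μ (restrictSemigroup α T) t) = specRadius (funcCalc μ T t) := by
  let j : semigroupAlgebra α T →ₙₐ[ℂ] B := NonUnitalSubalgebraClass.subtype (semigroupAlgebra α T)
  have hj : j (funcCalc μ (restrictSemigroup α T) t) = funcCalc μ T t :=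
    (hT.restrict.map_funcCalc hμ j continuous_subtype_val ht).trans <|
      congrArg (cintegral μ) (funext fun ξ => coe_restrictSemigroup (ofReal_mul_mem_sector ht ξ.2))
  rw [← hj, specRadius_map_of_norm_eq j fun _ => rfl]

theorem eq_zero_of_forall_restrictSemigroup {F : Type*} [NonUnitalNormedRing F] [NormedSpace ℂ F]
    (f : semigroupAlgebra α T →ₙₐ[ℂ] F) (hf : Continuous f)
    (h : ∀ t ∈ sector α, f (restrictSemigroup α T t) = 0) : f = 0 := by
  let N := (NonUnitalAlgHom.equalizer f 0).map
    (NonUnitalSubalgebraClass.subtype (semigroupAlgebra α T))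
  have hN : IsClosed (N : Set B) :=
    isClosed_semigroupAlgebra.isClosedEmbedding_subtypeVal.isClosedMap _
      (isClosed_eq hf continuous_const)
  have hle : semigroupAlgebra α T ≤ N := by
    refine NonUnitalSubalgebra.topologicalClosure_minimal (NonUnitalAlgebra.adjoin_le ?_) hN
    rintro _ ⟨t, ht, rfl⟩
    exact ⟨restrictSemigroup α T t, h t ht, coe_restrictSemigroup ht⟩
  ext x
  obtain ⟨y, hy, hyx⟩ := hle x.2
  rw [← Subtype.ext hyx]
  exact hy

theorem IsAnalyticSemigroup.exists_isBoundedGenerator [CompleteSpace B]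
    (hT : IsAnalyticSemigroup α T) (hα₀ : 0 < α) {μ : ComplexMeasure (sector α)}
    (hμ : HasCompactSupp μ) (hμ₀ : μ univ = 0)
    (hreal : ∀ x : ℝ, 0 < x → (laplace μ x).im = 0) {t₀ : ℝ} (ht₀ : 0 < t₀)
    (hlt : ∀ t : ℝ, 0 < t → t ≤ t₀ → specRadius (funcCalc μ T t) < supOnPos (laplace μ)) :
    ∃ e : ModRad (semigroupAlgebra α T), IsIdentity e ∧ ∃ u, IsBoundedGenerator T e u := by
  let := hT.nonUnitalNormedCommRing
  have hbdd : Bornology.IsBounded (exponentSet α (restrictSemigroup α T)) :=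
    hT.restrict.isBounded_exponentSet hα₀ hμ hμ₀ hreal ht₀ fun t ht htt₀ =>
      (hT.specRadius_funcCalc_restrictSemigroup hμ ht).trans_lt (hlt t ht htt₀)
  obtain ⟨e, he, u, hu⟩ := hT.restrict.exists_identity_and_generator hα₀
    (fun f => eq_zero_of_forall_restrictSemigroup f (continuous_hom f)) hbdd
  refine ⟨e, he, u, fun t => ?_⟩
  have := hu t t.2
  rwa [restrictSemigroup_of_mem t.2] at this

end GeneratedAlgebra

section PowSemigroup

open unitInterval

/-- Evaluation at a point, as a multiplicative functional on `C₀([0,1])`. -/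
noncomputable def evalHom (x : I) : ContinuousMapZero I ℂ →ₙₐ[ℂ] ℂ where
  toFun g := g x
  map_add' _ _ := rfl
  map_mul' _ _ := rfl
  map_zero' := rfl
  map_smul' _ _ := rfl

theorem specRadius_eq_iSup_enorm (g : ContinuousMapZero I ℂ) : specRadius g = ⨆ x, ‖g x‖ₑ :=
  ((specRadius_le_enorm g).trans_eq (ContinuousMap.enorm_eq_iSup_enorm (g : C(I, ℂ)))).antisymm <|
    iSup_le fun x => enorm_apply_le_specRadius (evalHom x) g

theorem exists_ne_zero_apply_ne_one (g : ContinuousMapZero I ℂ) : ∃ x ≠ 0, g x ≠ 1 := by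
  by_contra! h
  have : (𝓝[>] (0 : I)).NeBot := nhdsGT_neBot_of_exists_gt ⟨1, zero_lt_one⟩
  have h₀ : Tendsto g (𝓝[>] 0) (𝓝 0) :=
    ((map_continuous g).tendsto' 0 0 (map_zero g)).mono_left nhdsWithin_le_nhds
  have h₁ : Tendsto g (𝓝[>] 0) (𝓝 1) :=
    tendsto_const_nhds.congr' <| by
      filter_upwards [self_mem_nhdsWithin] with x hx using (h x hx.ne').symm
  exact zero_ne_one (tendsto_nhds_unique h₀ h₁)

theorem powSemigroup_apply {t : ℂ} (ht : 0 < t.re) (x : I) :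
    powSemigroup t x = ((x : ℝ) : ℂ) ^ t := by
  rw [powSemigroup, dif_pos ht]
  rfl

theorem powSemigroup_apply_of_ne_zero {t : ℂ} (ht : 0 < t.re) {x : I} (hx : x ≠ 0) :
    powSemigroup t x = Complex.exp (Real.log x * t) := by
  rw [powSemigroup_apply ht, Complex.cpow_def_of_ne_zero (by exact_mod_cast coe_ne_zero.2 hx),
    Complex.ofReal_log x.2.1]

theorem continuous_cpow_mul_log {t : ℂ} (ht : 0 < t.re) :
    Continuous fun x : I => ((x : ℝ) : ℂ) ^ t * Real.log x := by
  set s : ℝ := t.re / 2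
  have hs : 0 < s := by positivity
  have hts : 0 < (t - s).re := by simpa [s] using half_lt_self ht
  have hrpow : Continuous fun x : I => (x : ℝ) ^ s * Real.log ((x : ℝ) ^ s) :=
    Real.continuous_mul_log.comp (continuous_subtype_val.rpow_const fun _ => Or.inr hs.le)
  -- `x ^ t log x = s⁻¹ x ^ (t - s) (x ^ s log (x ^ s))`, where `y log y` is continuous at `0`
  convert! ((map_continuous (powSemigroup (t - s))).mul
    (Complex.continuous_ofReal.comp hrpow)).const_mul (s : ℂ)⁻¹ using 2 with x
  rcases eq_or_ne x 0 with rfl | hx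
  · simp
  · have hx' : 0 < (x : ℝ) := unitInterval.pos_iff_ne_zero.2 hx
    have hsplit : ((x : ℝ) : ℂ) ^ t = ((x : ℝ) : ℂ) ^ (t - s) * ((x : ℝ) : ℂ) ^ (s : ℂ) := by
      rw [← Complex.cpow_add _ _ (by exact_mod_cast hx'.ne'), sub_add_cancel]
    have hs' : (s : ℂ) ≠ 0 := by exact_mod_cast hs.ne'
    rw [Pi.mul_apply, Function.comp_apply, powSemigroup_apply hts, Real.log_rpow hx', hsplit]
    push_cast [Complex.ofReal_cpow hx'.le]
    field_simp

/-- The function `x ↦ x ^ t log x`, the derivative of the semigroup of powers at `t`. -/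
noncomputable def powLog (t : ℂ) (ht : 0 < t.re) : ContinuousMapZero I ℂ where
  toFun x := ((x : ℝ) : ℂ) ^ t * Real.log x
  continuous_toFun := continuous_cpow_mul_log ht
  map_zero' := by simp

theorem norm_exp_mul_add_sub_le {l : ℝ} (hl : l ≤ 0) {t w : ℂ} (ht : 0 < t.re)
    (hw : ‖w‖ ≤ t.re / 2) :
    ‖Complex.exp (l * (t + w)) - Complex.exp (l * t) - w * (Complex.exp (l * t) * l)‖ ≤
      8 / t.re ^ 2 * ‖w‖ ^ 2 := by
  set y : ℝ := -l * (t.re / 2)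
  have hy : 0 ≤ y := mul_nonneg (neg_nonneg.2 hl) (by positivity)
  have hlw : ‖(l : ℂ) * w‖ = -l * ‖w‖ := by
    rw [norm_mul, Complex.norm_real, Real.norm_of_nonpos hl]
  have htaylor : ‖Complex.exp (l * w) - 1 - l * w‖ ≤ (-l * ‖w‖) ^ 2 * Real.exp y := by
    have h := Complex.norm_exp_sub_sum_le_norm_mul_exp (l * w) 2
    rw [hlw] at h
    calc ‖Complex.exp (l * w) - 1 - l * w‖ ≤ (-l * ‖w‖) ^ 2 * Real.exp (-l * ‖w‖) := by
          simpa [Finset.sum_range_succ, sub_sub] using h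
      _ ≤ (-l * ‖w‖) ^ 2 * Real.exp y := by
          gcongr
          exact mul_le_mul_of_nonneg_left hw (neg_nonneg.2 hl)
  have hexp : y ^ 2 * Real.exp (-y) ≤ 2 := by
    rw [Real.exp_neg, ← div_eq_mul_inv, div_le_iff₀ (Real.exp_pos y)]
    linarith [Real.quadratic_le_exp_of_nonneg hy]
  calc ‖Complex.exp (l * (t + w)) - Complex.exp (l * t) - w * (Complex.exp (l * t) * l)‖
      = ‖Complex.exp (l * t) * (Complex.exp (l * w) - 1 - l * w)‖ := by
        rw [mul_add, Complex.exp_add]; ring_nf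
    _ ≤ Real.exp (l * t.re) * ((-l * ‖w‖) ^ 2 * Real.exp y) := by
        rw [norm_mul, Complex.norm_exp, Complex.re_ofReal_mul]
        gcongr
    _ = y ^ 2 * Real.exp (-y) * (4 / t.re ^ 2 * ‖w‖ ^ 2) := by
        have hsum : Real.exp (l * t.re) * Real.exp y = Real.exp (-y) := by
          rw [← Real.exp_add]; simp only [y]; ring_nf
        rw [← hsum]
        simp only [y]
        field_simp
        ring
    _ ≤ 2 * (4 / t.re ^ 2 * ‖w‖ ^ 2) := by gcongr
    _ = 8 / t.re ^ 2 * ‖w‖ ^ 2 := by ring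

theorem hasDerivAt_powSemigroup {t : ℂ} (ht : 0 < t.re) :
    HasDerivAt powSemigroup (powLog t ht) t := by
  refine hasDerivAt_of_norm_sub_le_sq (δ := t.re / 2) (C := 8 / t.re ^ 2) (by positivity)
    fun w hw => (ContinuousMap.norm_le _ (by positivity)).2 fun x => ?_
  change ‖powSemigroup (t + w) x - powSemigroup t x - w * (((x : ℝ) : ℂ) ^ t * Real.log x)‖ ≤ _
  rcases eq_or_ne x 0 with rfl | hx
  · simpa using by positivity
  · have htw : 0 < (t + w).re := by
      rw [Complex.add_re]
      linarith [(abs_le.1 (Complex.abs_re_le_norm w)).1]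
    rw [← powSemigroup_apply ht, powSemigroup_apply_of_ne_zero htw hx,
      powSemigroup_apply_of_ne_zero ht hx]
    exact norm_exp_mul_add_sub_le (Real.log_nonpos x.2.1 x.2.2) ht hw.le

variable {α : ℝ}

theorem isAnalyticSemigroup_powSemigroup : IsAnalyticSemigroup α powSemigroup where
  differentiableOn t ht := (hasDerivAt_powSemigroup ht.1).differentiableAt.differentiableWithinAt
  map_add s hs t ht := by
    ext x
    change powSemigroup (s + t) x = powSemigroup s x * powSemigroup t x
    rcases eq_or_ne x 0 with rfl | hx
    · simp
    · rw [powSemigroup_apply_of_ne_zero (add_pos hs.1 ht.1) hx,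
        powSemigroup_apply_of_ne_zero hs.1 hx, powSemigroup_apply_of_ne_zero ht.1 hx, mul_add,
        Complex.exp_add]

theorem not_isQuasinilpotent_powSemigroup (hα₀ : 0 < α) : ¬ IsQuasinilpotent α powSemigroup := by
  intro h
  have h₁ : (1 : ℂ) ∈ sector α := by simpa using ofReal_mem_sector hα₀ one_pos
  have hle := enorm_apply_le_specRadius (evalHom 1) (powSemigroup 1)
  have heval : evalHom 1 (powSemigroup 1) = 1 := (powSemigroup_apply h₁.1 1).trans (by simp)
  rw [h 1 h₁, heval] at hle
  simp at hle

theorem funcCalc_powSemigroup_apply {μ : ComplexMeasure (sector α)} (hμ : HasCompactSupp μ) {t : ℝ}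
    (ht : 0 < t) {x : I} (hx : x ≠ 0) :
    funcCalc μ powSemigroup t x = laplace μ ((-(t * Real.log x) : ℝ) : ℂ) := by
  refine (isAnalyticSemigroup_powSemigroup.map_funcCalc hμ (evalHom x) (continuous_hom _)
    ht).trans (congrArg (cintegral μ) (funext fun ξ => ?_))
  refine (powSemigroup_apply_of_ne_zero (ofReal_mul_mem_sector ht ξ.2).1 hx).trans
    (congrArg Complex.exp ?_)
  push_cast
  ring

theorem specRadius_funcCalc_powSemigroup {μ : ComplexMeasure (sector α)} (hμ : HasCompactSupp μ)
    (hμ₀ : μ univ = 0) {t : ℝ} (ht : 0 < t) :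
    specRadius (funcCalc μ powSemigroup t) = supOnPos (laplace μ) := by
  rw [specRadius_eq_iSup_enorm]
  refine le_antisymm (iSup_le fun x => ?_) (iSup₂_le fun y hy => ?_)
  · rcases eq_or_ne x 0 with rfl | hx
    · simp
    rw [funcCalc_powSemigroup_apply hμ ht hx]
    rcases x.2.2.eq_or_lt with hx₁ | hx₁
    · simp [hx₁, laplace_zero, hμ₀]
    · have hlog : 0 < -(t * Real.log x) :=
        neg_pos.2 (mul_neg_of_pos_of_neg ht (Real.log_neg (unitInterval.pos_iff_ne_zero.2 hx) hx₁))
      exact le_iSup₂ (f := fun (y : ℝ) (_ : 0 < y) => ‖laplace μ y‖ₑ) _ hlog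
  · let x : I := ⟨Real.exp (-(y / t)), (Real.exp_pos _).le,
      Real.exp_le_one_iff.2 (neg_nonpos.2 (by positivity))⟩
    have hx : x ≠ 0 := coe_ne_zero.1 (Real.exp_pos _).ne'
    have hlog : -(t * Real.log x) = y := by
      simp only [x, Real.log_exp]
      field_simp
    calc ‖laplace μ y‖ₑ = ‖funcCalc μ powSemigroup t x‖ₑ := by
          rw [funcCalc_powSemigroup_apply hμ ht hx, hlog]
      _ ≤ ⨆ x, ‖funcCalc μ powSemigroup t x‖ₑ := le_iSup (fun x => ‖funcCalc μ powSemigroup t x‖ₑ) x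

theorem not_exists_isIdentity_powSemigroup (hα₀ : 0 < α) :
    ¬ ∃ e : ModRad (semigroupAlgebra α powSemigroup), IsIdentity e := by
  rintro ⟨e, he⟩
  let := (isAnalyticSemigroup_powSemigroup (α := α)).nonUnitalNormedCommRing
  obtain ⟨p, rfl⟩ := (radical (semigroupAlgebra α powSemigroup)).mkQ_surjective e
  obtain ⟨x, hx, hpx⟩ := exists_ne_zero_apply_ne_one (p : ContinuousMapZero I ℂ)
  let f := (evalHom x).comp (NonUnitalSubalgebraClass.subtype (semigroupAlgebra α powSemigroup))
  have hf : f = 0 := (isIdentity_toModRad_iff.1 he f).resolve_left hpx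
  have h₁ : (1 : ℂ) ∈ sector α := by simpa using ofReal_mem_sector hα₀ one_pos
  have hpow : powSemigroup 1 x = 0 := DFunLike.congr_fun hf ⟨_, mem_semigroupAlgebra _ h₁⟩
  rw [powSemigroup_apply_of_ne_zero h₁.1 hx] at hpow
  exact Complex.exp_ne_zero _ hpow

theorem not_exists_tendsto_powSemigroup :
    ¬ ∃ L, Tendsto (fun t : ℝ => powSemigroup t) (𝓝[>] 0) (𝓝 L) := by
  rintro ⟨L, hL⟩
  obtain ⟨x, hx, hLx⟩ := exists_ne_zero_apply_ne_one L
  have hlim : Tendsto (fun t : ℝ => powSemigroup t x) (𝓝[>] 0) (𝓝 (L x)) :=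
    ((continuous_hom (evalHom x)).tendsto L).comp hL
  have hexp : Tendsto (fun t : ℝ => Complex.exp (Real.log x * t)) (𝓝[>] 0) (𝓝 1) := by
    have hcont : Continuous fun t : ℝ => Complex.exp (Real.log x * t) := by fun_prop
    exact (hcont.tendsto' 0 1 (by simp)).mono_left nhdsWithin_le_nhds
  refine hLx (tendsto_nhds_unique hlim (hexp.congr' ?_))
  filter_upwards [self_mem_nhdsWithin] with t ht
  exact (powSemigroup_apply_of_ne_zero (by simpa using ht) hx).symm

end PowSemigroup

end SectorSemigroup

open SectorSemigroup in
theorem theorem3p5_general (α : ℝ) (hα₀ : 0 < α) (φ : holSpace α →L[ℂ] ℂ)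
    (μ : ComplexMeasure (sector α)) (hφμ : IsInducedBy φ μ) (hsupp : HasCompactSupp μ)
    (hμ : μ Set.univ = 0) :
    ((∀ x : ℝ, 0 < x → (fourierBorel φ x).im = 0) →
      ∀ (B : Type*) [NonUnitalNormedRing B] [NormedSpace ℂ B] [IsScalarTower ℂ B B]
        [SMulCommClass ℂ B B] [CompleteSpace B] (T : ℂ → B), IsAnalyticSemigroup α T →
        (∃ t₀ : ℝ, 0 < t₀ ∧ ∀ t : ℝ, 0 < t → t ≤ t₀ →
          specRadius (funcCalc μ T t) < supOnPos (fourierBorel φ)) →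
        ∃ e : ModRad (semigroupAlgebra α T), IsIdentity e ∧ ∃ u, IsBoundedGenerator T e u) ∧
    (IsAnalyticSemigroup α powSemigroup ∧ ¬ IsQuasinilpotent α powSemigroup ∧
      (∀ t : ℝ, 0 < t →
        specRadius (funcCalc μ powSemigroup t) = supOnPos (fourierBorel φ)) ∧
      (¬ ∃ e : ModRad (semigroupAlgebra α powSemigroup), IsIdentity e) ∧
      ¬ ∃ L, Tendsto (fun t : ℝ => powSemigroup t) (𝓝[>] 0) (𝓝 L)) := by
  rw [hφμ.fourierBorel_eq_laplace]
  exact ⟨fun hreal B _ _ _ _ _ T hT ⟨_, ht₀, hlt⟩ =>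
      hT.exists_isBoundedGenerator hα₀ hsupp hμ hreal ht₀ hlt,
    isAnalyticSemigroup_powSemigroup, not_isQuasinilpotent_powSemigroup hα₀,
    fun _ ht => specRadius_funcCalc_powSemigroup hsupp hμ ht,
    not_exists_isIdentity_powSemigroup hα₀, not_exists_tendsto_powSemigroup⟩

open SectorSemigroup in
theorem theorem3p5 (α : ℝ) (hα₀ : 0 < α) (hα₁ : α < Real.pi / 2)
    (φ : holSpace α →L[ℂ] ℂ) (μ : ComplexMeasure (sector α))
    (hφμ : IsInducedBy φ μ) (hsupp : HasCompactSupp μ) (hsymm : IsSymmetric μ)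
    (hμ : μ Set.univ = 0)
    (hreal : ∀ x : ℝ, 0 < x → (fourierBorel φ x).im = 0) :
    (∀ (B : Type*) [NonUnitalNormedRing B] [NormedSpace ℂ B] [IsScalarTower ℂ B B]
        [SMulCommClass ℂ B B] [CompleteSpace B] (T : ℂ → B),
        IsAnalyticSemigroup α T → ¬ IsQuasinilpotent α T →
        (∃ t₀ : ℝ, 0 < t₀ ∧ ∀ t : ℝ, 0 < t → t ≤ t₀ →
          specRadius (funcCalc μ T t) < supOnPos (fourierBorel φ)) →
        ∃ e : ModRad (semigroupAlgebra α T), IsIdentity e ∧ ∃ u, IsBoundedGenerator T e u) ∧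
    (IsAnalyticSemigroup α powSemigroup ∧ ¬ IsQuasinilpotent α powSemigroup ∧
      (∀ t : ℝ, 0 < t →
        specRadius (funcCalc μ powSemigroup t) = supOnPos (fourierBorel φ)) ∧
      (¬ ∃ e : ModRad (semigroupAlgebra α powSemigroup), IsIdentity e) ∧
      ¬ ∃ L, Tendsto (fun t : ℝ => powSemigroup t) (𝓝[>] 0) (𝓝 L)) := by
  have h := theorem3p5_general α hα₀ φ μ hφμ hsupp hμ
  exact ⟨fun B _ _ _ _ _ T hT _ => h.1 hreal B T hT, h.2⟩
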